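/- **Average-distortion sketching for $\ell_p$.** Let $(X,d_X)$ be a finite metric space and $\mu$ a probability distribution on $X$. An *average-distortion sketch for $\mu$ with space complexity $s$ and distortion $c\ge 1$* is a probability distribution $\mathcal D$ over pairs $(\mathsf{sk},\mathsf{Alg})$, where $\mathsf{sk}\colon X\to\{0,1\}^s$ is a function and $\mathsf{Alg}$ maps two elements of $\{0,1\}^s$ to a number in $\mathbb R_{\ge 0}$, such that * (non-expansion) for all $x,y\in X$: $\ \mathbb E_{(\mathsf{sk},\mathsf{Alg})\sim\mathcal D}\big[\mathsf{Alg}(\mathsf{sk}(x),\mathsf{sk}(y))\big]\le d_X(x,y)$; * (bounded contraction) $\ \mathbb E_{x,y\sim\mu,\,(\mathsf{sk},\mathsf{Alg})\sim\mathcal D}\big[\mathsf{Alg}(\mathsf{sk}(x),\mathsf{sk}(y))\big]\ge \frac1c\,\mathbb E_{x,y\sim\mu}\big[d_X(x,y)\big]$, where $x$, $y$ and $(\mathsf{sk},\mathsf{Alg})$ are drawn independently. For integers $d,\Delta\ge 1$ let $[\Delta]^d=\{1,\dots,\Delta\}^d$ with the metric $\|x-y\|_p$. There are universal constants $c_0\ge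 1$, $C$ and $k\in\mathbb N$ such that for every real $c>c_0$, every $p\in[1,\infty)$ and all integers $d,\Delta\ge1$ the following hold. 1. There is an integer $s\le C\,\big(c\cdot p\cdot 2^{p/c}\cdot\log(d\Delta)\big)^k$ such that every probability distribution $\mu$ on $([\Delta]^d,\ell_p)$ has an average-distortion sketch with space complexity $s$ and distortion $c$. 2. For every $\delta\in(0,1)$ there is an integer $s\le C\,\big(c\cdot p\cdot 2^{p/c}\cdot\log(d\Delta/\delta)\big)^k$ such that every probability distribution $\mu$ on $([\Delta]^d,\ell_p)$ has an average-distortion sketch $\mathcal D$ with space complexity $s$ and distortion $c$ which moreover satisfies, for all $x,y\in[\Delta]^d$, $\ \Pr_{(\mathsf{sk},\mathsf{Alg})\sim\mathcal D}\big[\mathsf{Alg}(\mathsf{sk}(x),\mathsf{sk}(y))\le\|x-y\|_p\big]\ge 1-\delta$. -/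

import Mathlib

open MeasureTheory
open scoped ENNReal NNReal

/-- Strings of `s` bits. -/
abbrev Bits (s : ℕ) : Type := Fin s → Bool

/-- A deterministic sketch of `X` with space complexity `s`: a pair `(sk, Alg)` of a sketching map
`sk : X → {0,1}^s` and a decoder `Alg`, which receives two sketches and outputs a nonnegative
real number. The type carries the product `σ`-algebra. -/
abbrev SketchPair (X : Type*) (s : ℕ) : Type _ := (X → Bits s) × (Bits s → Bits s → ℝ≥0)

/-- The output `Alg (sk x, sk y)`. -/
def SketchPair.output {X : Type*} {s : ℕ} (t : SketchPair X s) (x y : X) : ℝ≥0 :=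
  t.2 (t.1 x) (t.1 y)

/-- `D`, a distribution over pairs `(sk, Alg)` with `sk : X → {0,1}^s`, is an average-distortion
sketch for the distribution `μ` on the metric space `X`, with average distortion `c`.
Expectations of nonnegative quantities are Lebesgue integrals with values in `[0, ∞]`.
(The definition is used for finite `X`, where everything is measurable.) -/
structure IsAvgDistortionSketch {X : Type*} [MetricSpace X] [MeasurableSpace X] {s : ℕ}
    (μ : Measure X) (c : ℝ) (D : Measure (SketchPair X s)) : Prop where
  /-- `D` is a probability distribution. -/
  isProbabilityMeasure : IsProbabilityMeasure D
  /-- The expected output does not exceed the distance, for any two points. -/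
  non_expansion : ∀ x y : X, ∫⁻ t, (t.output x y : ℝ≥0∞) ∂D ≤ edist x y
  /-- For independent `x, y ∼ μ` and `(sk, Alg) ∼ D`, the expected output is at least `1 / c`
  times the expected distance. -/
  bounded_contraction :
    (ENNReal.ofReal c)⁻¹ * ∫⁻ z, edist z.1 z.2 ∂(μ.prod μ) ≤
      ∫⁻ w, (w.2.output w.1.1 w.1.2 : ℝ≥0∞) ∂((μ.prod μ).prod D)

/-- The grid `[Δ]^d = {1, …, Δ}^d` inside `ℝ^d` with the `ℓ_p` norm; as a subtype it carries the
`ℓ_p` metric. -/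
def lpGrid (p : ℝ≥0∞) (d Δ : ℕ) : Set (PiLp p (fun _ : Fin d => ℝ)) :=
  {x | ∀ i, ∃ k : ℕ, 1 ≤ k ∧ k ≤ Δ ∧ x i = (k : ℝ)}

/-! Translate the grid so that the origin is a coordinatewise median of `μ`. Let `R` be a median of
the rounded-up norm and `J` the mean excess of that norm over `R`; then the mean distance is at most
`2(R + J)`.

If `R ≤ J`, the distances are governed by the norms. The excess over `R` vanishes on half of the
mass, so storing this one integer and outputting half the difference already captures `J` up to a
constant.

If `J < R`, project radially to the ball of radius `R/2` and rescale: half of the mass lands on the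
unit sphere. Split coordinates into positive and negative parts; by the choice of the origin, each
part vanishes on half of the mass. Draw independent uniform thresholds, one per part, and store for
each point the coordinates whose `p`-th power exceeds the threshold, and a second set in which the
point is enlarged by `1/(1 - η)`. The pair is separated if the first set of `x` is not contained in
the second set of `y`. A random pair is separated with constant probability: a coordinate of `x`
that survives its threshold is zero for half of the `y`. For close pairs, the gap `η` bounds the
probability by `2(‖x - y‖/η)^p` after rescaling. Repeating `16m` times and outputting a fixed `w` of
order `ηR` once `m` trials separate makes the error `2^{-m}`.

The stored sets have expected size at most `(1 - η)^{-p}`; with `η` of order `1/c` this is a power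
of `2^{p/c}`. The main steps are `volume_separatingSet_le`, `lintegral_volume_separatingSet_ge`,
`exists_threshold_sketch` and `exists_sketch_of_coordinatewise_median_zero`. -/

/-! ### From random maps into finite sets to sketches. -/

/-- The sketch pair obtained from a map into a finite type by encoding its values as bit strings. -/
noncomputable def SketchPair.ofEmbedding {X S : Type*} {s : ℕ} [Nonempty S] (enc : S ↪ Bits s)
    (sk : X → S) (alg : S → S → ℝ≥0) : SketchPair X s :=
  (fun x => enc (sk x), fun a b => alg (Function.invFun enc a) (Function.invFun enc b))

lemma SketchPair.output_ofEmbedding {X S : Type*} {s : ℕ} [Nonempty S] (enc : S ↪ Bits s)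
    (sk : X → S) (alg : S → S → ℝ≥0) (x y : X) :
    (SketchPair.ofEmbedding enc sk alg).output x y = alg (sk x) (sk y) := by
  simp [SketchPair.ofEmbedding, SketchPair.output, Function.leftInverse_invFun enc.injective _]

lemma SketchPair.measurable_output {X : Type*} {s : ℕ} (x y : X) :
    Measurable fun t : SketchPair X s => t.output x y := by
  -- The decoder is evaluated at a random pair of strings; there are finitely many pairs, so each
  -- can be treated separately.
  have h : Measurable fun q : (Bits s × Bits s) × (Bits s → Bits s → ℝ≥0) => q.2 q.1.1 q.1.2 := by
    refine measurable_from_prod_countable_right fun q => ?_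
    exact (measurable_pi_apply q.2).comp (measurable_pi_apply q.1)
  refine h.comp (g := fun q => q.2 q.1.1 q.1.2)
    (f := fun t : SketchPair X s => ((t.1 x, t.1 y), t.2)) ?_
  exact (((measurable_pi_apply x).comp measurable_fst).prodMk
    ((measurable_pi_apply y).comp measurable_fst)).prodMk measurable_snd

/-- A random map into a finite set `S`, with a decoder on `S`, gives an average-distortion sketch
with `s` bits as soon as `S` has at most `2 ^ s` elements. -/
lemma exists_sketch_of_random_map {X : Type*} [MetricSpace X] [MeasurableSpace X] [Countable X]
    [DiscreteMeasurableSpace X] {μ : Measure X} [IsProbabilityMeasure μ]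
    {S : Type*} [Fintype S] {s : ℕ} (hS : Fintype.card S ≤ 2 ^ s)
    {Ω : Type*} [MeasurableSpace Ω] {P : Measure Ω} [IsProbabilityMeasure P]
    {sk : Ω → X → S} (hsk : ∀ x t, MeasurableSet {ω | sk ω x = t})
    {alg : S → S → ℝ≥0} {c : ℝ}
    (hne : ∀ x y, ∫⁻ ω, (alg (sk ω x) (sk ω y) : ℝ≥0∞) ∂P ≤ edist x y)
    (hbc : (ENNReal.ofReal c)⁻¹ * ∫⁻ z, edist z.1 z.2 ∂(μ.prod μ) ≤
      ∫⁻ z, ∫⁻ ω, (alg (sk ω z.1) (sk ω z.2) : ℝ≥0∞) ∂P ∂(μ.prod μ)) :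
    ∃ D : Measure (SketchPair X s), IsAvgDistortionSketch μ c D ∧
      ∀ (x y : X) (r : ℝ),
        D {t | (t.output x y : ℝ) ≤ r} = P {ω | (alg (sk ω x) (sk ω y) : ℝ) ≤ r} := by
  obtain ⟨x₀⟩ : Nonempty X := μ.nonempty_of_neZero
  obtain ⟨ω₀⟩ : Nonempty Ω := P.nonempty_of_neZero
  have : Nonempty S := ⟨sk ω₀ x₀⟩
  obtain ⟨enc⟩ : Nonempty (S ↪ Bits s) :=
    Function.Embedding.nonempty_of_card_le (by simpa using hS)
  let T : Ω → SketchPair X s := fun ω => SketchPair.ofEmbedding enc (sk ω) alg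
  have hT : Measurable T := by
    let _ : MeasurableSpace S := ⊤
    have hsk' : ∀ x, Measurable fun ω => sk ω x := fun x =>
      measurable_to_countable' fun t => hsk x t
    have henc : Measurable enc := measurable_from_top
    exact (measurable_pi_iff.2 fun x => henc.comp (hsk' x)).prodMk measurable_const
  have hout : ∀ ω x y, (T ω).output x y = alg (sk ω x) (sk ω y) := fun ω x y =>
    SketchPair.output_ofEmbedding enc (sk ω) alg x y
  have hlint : ∀ x y, ∫⁻ t, (t.output x y : ℝ≥0∞) ∂(P.map T) =
      ∫⁻ ω, (alg (sk ω x) (sk ω y) : ℝ≥0∞) ∂P := by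
    intro x y
    rw [lintegral_map (SketchPair.measurable_output x y).coe_nnreal_ennreal hT]
    simp only [hout]
  have : IsProbabilityMeasure (P.map T) := Measure.isProbabilityMeasure_map hT.aemeasurable
  refine ⟨P.map T, ⟨this, fun x y => (hlint x y).trans_le (hne x y), ?_⟩, ?_⟩
  · refine hbc.trans_eq ?_
    rw [lintegral_prod (μ := μ.prod μ)]
    · simp only [hlint]
    · refine Measurable.aemeasurable (measurable_from_prod_countable_right fun z => ?_)
      exact (SketchPair.measurable_output z.1 z.2).coe_nnreal_ennreal
  · intro x y r
    rw [Measure.map_apply hT]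
    · simp only [Set.preimage_ofPred_eq, hout]
    · exact measurableSet_le (SketchPair.measurable_output x y).coe_nnreal_real measurable_const

/-! ### Medians and independent uniform thresholds. -/

/-- A natural-number-valued bounded function has a median. -/
lemma exists_nat_median {X : Type*} [MeasurableSpace X] [DiscreteMeasurableSpace X]
    (μ : Measure X) [IsProbabilityMeasure μ] (g : X → ℕ) {B : ℕ} (hB : ∀ x, g x ≤ B) :
    ∃ k ≤ B, 1 / 2 ≤ μ {x | g x ≤ k} ∧ 1 / 2 ≤ μ {x | k ≤ g x} := by
  classical
  have hex : ∃ k, 1 / 2 ≤ μ {x | g x ≤ k} := ⟨B, by simp [hB]⟩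
  refine ⟨Nat.find hex, Nat.find_min' hex (by simp [hB]), Nat.find_spec hex, ?_⟩
  -- Zero is treated apart because `Nat.find hex - 1` is truncated there.
  rcases Nat.eq_zero_or_pos (Nat.find hex) with h0 | hpos
  · rw [h0]
    simp
  · have h1 : μ {x | g x ≤ Nat.find hex - 1} < 1 / 2 :=
      not_le.1 (Nat.find_min hex (Nat.sub_lt hpos one_pos))
    have h2 : {x | Nat.find hex ≤ g x} = {x | g x ≤ Nat.find hex - 1}ᶜ := by
      ext x
      simp only [Set.mem_ofPred_eq, Set.mem_compl_iff]
      omega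
    rw [h2, prob_compl_eq_one_sub .of_discrete]
    refine le_trans ?_ (tsub_le_tsub_left h1.le 1)
    simp

lemma unitInterval.volume_coe_le_le (r : ℝ) :
    (volume : Measure unitInterval) {u | (u : ℝ) ≤ r} ≤ ENNReal.ofReal r := by
  have h := unitInterval.measurePreserving_coe.measure_preimage
    (measurableSet_Iic (a := r)).nullMeasurableSet
  have h2 : {u : unitInterval | (u : ℝ) ≤ r} = (↑) ⁻¹' Set.Iic r := rfl
  rw [h2, h, Measure.restrict_apply measurableSet_Iic]
  refine (measure_mono (t := Set.Icc 0 r) fun u hu => ⟨hu.2.1, hu.1⟩).trans ?_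
  simp

lemma unitInterval.volume_le_coe_le (r : ℝ) :
    (volume : Measure unitInterval) {u | r ≤ (u : ℝ)} ≤ ENNReal.ofReal (1 - r) := by
  have h := unitInterval.measurePreserving_coe.measure_preimage
    (measurableSet_Ici (a := r)).nullMeasurableSet
  have h2 : {u : unitInterval | r ≤ (u : ℝ)} = (↑) ⁻¹' Set.Ici r := rfl
  rw [h2, h, Measure.restrict_apply measurableSet_Ici]
  refine (measure_mono (t := Set.Icc r 1) fun u hu => ⟨hu.1, hu.2.2⟩).trans ?_
  simp

lemma volume_coe_apply_le_le {α : Type*} [Fintype α] (e : α) (r : ℝ) :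
    (volume : Measure (α → unitInterval)) {ω | (ω e : ℝ) ≤ r} ≤ ENNReal.ofReal r := by
  have h := (measurePreserving_eval (fun _ : α => (volume : Measure unitInterval)) e).measure_preimage
    (s := {u | (u : ℝ) ≤ r}) (measurableSet_le measurable_subtype_coe
      measurable_const).nullMeasurableSet
  exact h.trans_le (unitInterval.volume_coe_le_le r)

lemma volume_exists_coe_le_le {α : Type*} [Fintype α] (r : α → ℝ) (hr : ∀ e, 0 ≤ r e) :
    (volume : Measure (α → unitInterval)) {ω | ∃ e, (ω e : ℝ) ≤ r e} ≤
      ENNReal.ofReal (∑ e, r e) := by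
  have h : {ω : α → unitInterval | ∃ e, (ω e : ℝ) ≤ r e} = ⋃ e, {ω | (ω e : ℝ) ≤ r e} := by
    ext; simp
  rw [h, ENNReal.ofReal_sum_of_nonneg fun e _ => hr e]
  exact (measure_iUnion_fintype_le _ _).trans
    (Finset.sum_le_sum fun e _ => volume_coe_apply_le_le e _)

/-- Independence and `1 - r ≤ exp (-r)`. It yields the chance that a unit vector has no coordinate
above its threshold. -/
lemma volume_forall_le_coe_le {α : Type*} [Fintype α] (r : α → ℝ) :
    (volume : Measure (α → unitInterval)) {ω | ∀ e, r e ≤ (ω e : ℝ)} ≤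
      ENNReal.ofReal (Real.exp (-∑ e, r e)) := by
  have h : {ω : α → unitInterval | ∀ e, r e ≤ (ω e : ℝ)} =
      Set.univ.pi fun e => {u : unitInterval | r e ≤ (u : ℝ)} := by
    ext; simp
  rw [h, volume_pi_pi, ← Finset.sum_neg_distrib, Real.exp_sum,
    ENNReal.ofReal_prod_of_nonneg fun e _ => (Real.exp_pos _).le]
  refine Finset.prod_le_prod' fun e _ => (unitInterval.volume_le_coe_le _).trans ?_
  exact ENNReal.ofReal_le_ofReal (by linarith [Real.add_one_le_exp (-r e)])

/-- The set of coordinates of `ω` lying below the levels `r`. -/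
noncomputable def belowSet {α : Type*} [Fintype α] (r : α → ℝ) (ω : α → unitInterval) : Finset α :=
  Finset.univ.filter fun e => (ω e : ℝ) < r e

lemma mem_belowSet {α : Type*} [Fintype α] {r : α → ℝ} {ω : α → unitInterval} {e : α} :
    e ∈ belowSet r ω ↔ (ω e : ℝ) < r e := by
  simp [belowSet]

lemma measurableSet_coe_apply_lt {α : Type*} (e : α) (r : ℝ) :
    MeasurableSet {ω : α → unitInterval | (ω e : ℝ) < r} :=
  measurableSet_lt (measurable_subtype_coe.comp (measurable_pi_apply e)) measurable_const

lemma measurableSet_belowSet_eq {α : Type*} [Fintype α] (r : α → ℝ) (F : Finset α) :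
    MeasurableSet {ω | belowSet r ω = F} := by
  have h : {ω | belowSet r ω = F} = ⋂ e, {ω | (ω e : ℝ) < r e ↔ e ∈ F} := by
    ext ω
    simp [Finset.ext_iff, mem_belowSet]
  rw [h]
  refine MeasurableSet.iInter fun e => ?_
  by_cases he : e ∈ F
  · simpa [he] using measurableSet_coe_apply_lt e (r e)
  · simp only [he, iff_false, not_lt]
    exact measurableSet_le measurable_const (measurable_subtype_coe.comp (measurable_pi_apply e))

lemma measurableSet_belowSet_mem {α : Type*} [Fintype α] (r : α → ℝ) (A : Set (Finset α)) :
    MeasurableSet {ω | belowSet r ω ∈ A} := by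
  have h : {ω | belowSet r ω ∈ A} = ⋃ F ∈ A, {ω | belowSet r ω = F} := by
    ext ω; simp
  rw [h]
  exact MeasurableSet.biUnion A.to_countable fun F _ => measurableSet_belowSet_eq r F

/-- Markov's inequality for the number of coordinates below the levels `r`. -/
lemma volume_card_belowSet_gt_le {α : Type*} [Fintype α] (r : α → ℝ) (hr : ∀ e, 0 ≤ r e) (K : ℕ) (hK : K ≠ 0) :
    (volume : Measure (α → unitInterval)) {ω | K < (belowSet r ω).card} ≤
      ENNReal.ofReal (∑ e, r e) / K := by
  have hcard : ∀ ω, ((belowSet r ω).card : ℝ≥0∞) =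
      ∑ e, {ω : α → unitInterval | (ω e : ℝ) < r e}.indicator 1 ω := by
    intro ω
    simp [belowSet, Set.indicator_apply]
  have hint : ∫⁻ ω : α → unitInterval, ((belowSet r ω).card : ℝ≥0∞) ≤
      ENNReal.ofReal (∑ e, r e) := by
    simp only [hcard]
    rw [lintegral_finsetSum _ fun e _ => measurable_one.indicator (measurableSet_coe_apply_lt e _),
      ENNReal.ofReal_sum_of_nonneg fun e _ => hr e]
    refine Finset.sum_le_sum fun e _ => ?_
    rw [lintegral_indicator_one (measurableSet_coe_apply_lt e _)]
    refine (measure_mono (t := {ω : α → unitInterval | (ω e : ℝ) ≤ r e}) ?_).trans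
      (volume_coe_apply_le_le e _)
    intro ω hω
    have h : (ω e : ℝ) < r e := hω
    exact h.le
  have hmeas : Measurable fun ω => ((belowSet r ω).card : ℝ≥0∞) := by
    simp only [hcard]
    exact Finset.measurable_fun_sum _ fun e _ =>
      measurable_one.indicator (measurableSet_coe_apply_lt e _)
  refine le_trans (measure_mono ?_) ((meas_ge_le_lintegral_div hmeas.aemeasurable
    (Nat.cast_ne_zero.2 hK) (ENNReal.natCast_ne_top K)).trans (by gcongr))
  intro ω hω
  have h : K < (belowSet r ω).card := hω
  simpa using h.le

/-! ### Amplification by independent trials. -/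

section Repetition

variable {Ω : Type*} [MeasurableSpace Ω]

open Classical in
/-- The number of indices `j` with `ω j ∈ E`. -/
noncomputable def hitCount {Ω : Type*} {N : ℕ} (E : Set Ω) (ω : Fin N → Ω) : ℕ :=
  (Finset.univ.filter fun j => ω j ∈ E).card

lemma natCast_hitCount_eq_sum {Ω : Type*} {N : ℕ} (E : Set Ω) (ω : Fin N → Ω) :
    (hitCount E ω : ℝ≥0∞) = ∑ j, {ω : Fin N → Ω | ω j ∈ E}.indicator 1 ω := by
  classical
  simp [hitCount, Set.indicator_apply]

lemma measurable_hitCount_section {Z : Type*} [MeasurableSpace Z] {G : Set (Z × Ω)}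
    (hG : MeasurableSet G) (N : ℕ) :
    Measurable fun q : Z × (Fin N → Ω) => (hitCount (Prod.mk q.1 ⁻¹' G) q.2 : ℝ≥0∞) := by
  have h : ∀ q : Z × (Fin N → Ω), (hitCount (Prod.mk q.1 ⁻¹' G) q.2 : ℝ≥0∞) =
      ∑ j, {q : Z × (Fin N → Ω) | (q.1, q.2 j) ∈ G}.indicator 1 q := fun q => by
    rw [natCast_hitCount_eq_sum]
    rfl
  simp only [h]
  exact Finset.measurable_fun_sum _ fun j _ => measurable_one.indicator
    ((measurable_fst.prodMk ((measurable_pi_apply j).comp measurable_snd)) hG)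

lemma measurableSet_hitCount_section_ge {Z : Type*} [MeasurableSpace Z] {G : Set (Z × Ω)}
    (hG : MeasurableSet G) (N m : ℕ) :
    MeasurableSet {q : Z × (Fin N → Ω) | m ≤ hitCount (Prod.mk q.1 ⁻¹' G) q.2} := by
  have h : {q : Z × (Fin N → Ω) | m ≤ hitCount (Prod.mk q.1 ⁻¹' G) q.2} =
      {q | (m : ℝ≥0∞) ≤ (hitCount (Prod.mk q.1 ⁻¹' G) q.2 : ℝ≥0∞)} := by
    ext q; simp
  rw [h]
  exact measurableSet_le measurable_const (measurable_hitCount_section hG N)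

lemma measurableSet_hitCount_ge {E : Set Ω} (hE : MeasurableSet E) (N m : ℕ) :
    MeasurableSet {ω : Fin N → Ω | m ≤ hitCount E ω} :=
  measurable_prodMk_left (x := ())
    (measurableSet_hitCount_section_ge (Z := Unit) (measurable_snd hE) N m)

/-- In `N` independent trials, the probability that an event of probability `β` occurs at least
`m` times is at most `2 ^ N * β ^ m`. -/
lemma pi_hitCount_ge_le (P : Measure Ω) [IsProbabilityMeasure P] (E : Set Ω) (N m : ℕ) :
    Measure.pi (fun _ : Fin N => P) {ω | m ≤ hitCount E ω} ≤ 2 ^ N * P E ^ m := by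
  classical
  -- Union bound over the `m`-element sets of successful indices.
  have hsub : {ω : Fin N → Ω | m ≤ hitCount E ω} ⊆
      ⋃ F ∈ Finset.univ.powersetCard m,
        Set.univ.pi fun j : Fin N => if j ∈ F then E else Set.univ := by
    intro ω (hω : m ≤ (Finset.univ.filter fun j => ω j ∈ E).card)
    obtain ⟨F, hF, hFm⟩ := Finset.exists_subset_card_eq hω
    simp only [Set.mem_iUnion]
    refine ⟨F, by simp [hFm], fun j _ => ?_⟩
    by_cases hj : j ∈ F
    · simpa [hj] using hF hj
    · simp [hj]
  refine (measure_mono hsub).trans ((measure_biUnion_finset_le _ _).trans ?_)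
  have hF : ∀ F ∈ (Finset.univ : Finset (Fin N)).powersetCard m,
      Measure.pi (fun _ : Fin N => P)
        (Set.univ.pi fun j : Fin N => if j ∈ F then E else Set.univ) = P E ^ m := by
    intro F hF
    rw [Measure.pi_pi]
    have : ∀ j, P (if j ∈ F then E else Set.univ) = if j ∈ F then P E else 1 := fun j => by
      split_ifs <;> simp
    simp only [this, Finset.prod_ite_mem, Finset.univ_inter, Finset.prod_const,
      (Finset.mem_powersetCard.1 hF).2]
  rw [Finset.sum_congr rfl hF, Finset.sum_const, nsmul_eq_mul, Finset.card_powersetCard,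
    Finset.card_univ, Fintype.card_fin]
  gcongr
  exact_mod_cast Nat.choose_le_two_pow N m

/-- If a random `z` and one trial are jointly successful with probability at least `1 / 8`, then
with probability at least `1 / 16` at least `m` of `16 * m` trials are successful. -/
lemma prod_pi_hitCount_ge {Z : Type*} [MeasurableSpace Z] (ν : Measure Z)
    [IsProbabilityMeasure ν] (P : Measure Ω) [IsProbabilityMeasure P] {G : Set (Z × Ω)}
    (hG : MeasurableSet G) (h : 1 / 8 ≤ ν.prod P G) {m : ℕ} (hm : 0 < m) :
    1 / 16 ≤ ν.prod (Measure.pi fun _ : Fin (16 * m) => P)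
      {q | m ≤ hitCount (Prod.mk q.1 ⁻¹' G) q.2} := by
  classical
  set Q := ν.prod (Measure.pi fun _ : Fin (16 * m) => P) with hQ
  set A : Set (Z × (Fin (16 * m) → Ω)) := {q | m ≤ hitCount (Prod.mk q.1 ⁻¹' G) q.2} with hA
  let Gj : Fin (16 * m) → Set (Z × (Fin (16 * m) → Ω)) := fun j => {q | (q.1, q.2 j) ∈ G}
  have hpres : ∀ j, MeasurePreserving (fun q : Z × (Fin (16 * m) → Ω) => (q.1, q.2 j)) Q
      (ν.prod P) := fun j =>
    (MeasurePreserving.id ν).prod (measurePreserving_eval (fun _ : Fin (16 * m) => P) j)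
  have hGj : ∀ j, MeasurableSet (Gj j) := fun j => (hpres j).measurable hG
  have hQG : ∀ j, Q (Gj j) = ν.prod P G := fun j =>
    (hpres j).measure_preimage hG.nullMeasurableSet
  have hcount : ∀ q : Z × (Fin (16 * m) → Ω), ((hitCount (Prod.mk q.1 ⁻¹' G) q.2 : ℕ) : ℝ≥0∞) =
      ∑ j, (Gj j).indicator 1 q := fun q => natCast_hitCount_eq_sum _ _
  have hAm : MeasurableSet A := measurableSet_hitCount_section_ge hG _ m
  -- Trials sharing `z` are dependent, so only the first moment is used: the mean is at least `2m`,
  -- while the count is at most `16m` on `A` and at most `m` off it.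
  have hlow : (2 * m : ℝ≥0∞) ≤ ∫⁻ q, ((hitCount (Prod.mk q.1 ⁻¹' G) q.2 : ℕ) : ℝ≥0∞) ∂Q := by
    simp only [hcount]
    rw [lintegral_finsetSum _ fun j _ => measurable_one.indicator (hGj j)]
    simp only [lintegral_indicator_one (hGj _), hQG, Finset.sum_const, Finset.card_univ,
      Fintype.card_fin, nsmul_eq_mul]
    calc (2 * m : ℝ≥0∞) = ((16 * m : ℕ) : ℝ≥0∞) * (1 / 8) := by
          push_cast
          rw [mul_right_comm, show (16 : ℝ≥0∞) = 2 * 8 by norm_num, mul_assoc 2 8,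
            ENNReal.mul_div_cancel (by norm_num) (by norm_num), mul_one]
      _ ≤ _ := by gcongr
  have hup : ∫⁻ q, ((hitCount (Prod.mk q.1 ⁻¹' G) q.2 : ℕ) : ℝ≥0∞) ∂Q ≤ 16 * m * Q A + m := by
    calc _ ≤ ∫⁻ q, (16 * m : ℝ≥0∞) * A.indicator 1 q + m ∂Q := by
          refine lintegral_mono fun q => ?_
          by_cases hq : q ∈ A
          · have : hitCount (Prod.mk q.1 ⁻¹' G) q.2 ≤ 16 * m := by
              simpa [hitCount] using Finset.card_filter_le (Finset.univ : Finset (Fin (16 * m)))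
                fun j => q.2 j ∈ Prod.mk q.1 ⁻¹' G
            have h2 : ((hitCount (Prod.mk q.1 ⁻¹' G) q.2 : ℕ) : ℝ≥0∞) ≤ 16 * m := by
              exact_mod_cast this
            simpa [hq] using h2.trans le_self_add
          · have : hitCount (Prod.mk q.1 ⁻¹' G) q.2 ≤ m := (not_le.1 hq).le
            simpa [hq] using this
      _ = 16 * m * Q A + m := by
          rw [lintegral_add_right _ measurable_const,
            lintegral_const_mul _ (measurable_one.indicator hAm), lintegral_indicator_one hAm]
          simp
  have hfin := hlow.trans hup
  have hm' : (m : ℝ) > 0 := by exact_mod_cast hm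
  have hQA : Q A ≠ ∞ := measure_ne_top _ _
  rw [← ENNReal.ofReal_toReal hQA] at hfin ⊢
  set q := (Q A).toReal
  have hq : 0 ≤ q := ENNReal.toReal_nonneg
  have h3 : (2 * m : ℝ) ≤ 16 * m * q + m := by
    have := ENNReal.toReal_mono (by finiteness) hfin
    rw [ENNReal.toReal_add (by finiteness) (by finiteness)] at this
    simpa [ENNReal.toReal_ofReal hq] using this
  have h4 : (1 / 16 : ℝ) ≤ q := by
    by_contra! hlt
    nlinarith
  calc (1 / 16 : ℝ≥0∞) = ENNReal.ofReal (1 / 16) := by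
        rw [ENNReal.ofReal_div_of_pos (by norm_num)]; simp
    _ ≤ _ := ENNReal.ofReal_le_ofReal h4

end Repetition

/-! ### Separation by random thresholds. -/

section ThresholdSketch

variable {X α : Type*} [Fintype α] {p η : ℝ} {K : ℕ} {a : X → α → ℝ}

/-- The event that the coordinates of `x` above the random thresholds are not all above the
thresholds lowered by the factor `1 - η` for `y`, and that at most `K` coordinates have to be
recorded for each of the two points. -/
def separatingSet (a : X → α → ℝ) (p η : ℝ) (K : ℕ) (x y : X) : Set (α → unitInterval) :=
  {ω | (belowSet (fun e => a x e ^ p) ω).card ≤ K ∧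
    (belowSet (fun e => (a y e / (1 - η)) ^ p) ω).card ≤ K ∧
    ¬ belowSet (fun e => a x e ^ p) ω ⊆ belowSet (fun e => (a y e / (1 - η)) ^ p) ω}

lemma measurableSet_separatingSet (x y : X) : MeasurableSet (separatingSet a p η K x y) := by
  have h : separatingSet a p η K x y = ⋃ A ∈ {A : Finset α | A.card ≤ K},
      ⋃ B ∈ {B : Finset α | B.card ≤ K ∧ ¬ A ⊆ B},
      {ω | belowSet (fun e => a x e ^ p) ω = A} ∩
        {ω | belowSet (fun e => (a y e / (1 - η)) ^ p) ω = B} := by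
    ext ω
    simp [separatingSet]
    tauto
  rw [h]
  refine MeasurableSet.biUnion (Set.to_countable _) fun A _ =>
    MeasurableSet.biUnion (Set.to_countable _) fun B _ => ?_
  exact (measurableSet_belowSet_eq _ A).inter (measurableSet_belowSet_eq _ B)

lemma separatingSet_self (hp : 0 ≤ p) (hη0 : 0 ≤ η) (hη1 : η < 1) (ha : ∀ x e, 0 ≤ a x e) (x : X) :
    separatingSet a p η K x x = ∅ := by
  refine Set.eq_empty_of_forall_notMem fun ω hω => hω.2.2 fun e he => ?_
  rw [mem_belowSet] at he ⊢
  refine he.trans_le (Real.rpow_le_rpow (ha x e) ?_ hp)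
  rw [le_div_iff₀ (by linarith)]
  nlinarith [ha x e]

/-- If `e` separates and `u = (ω e)^{1/p}`, then `a y e ≤ (1 - η) u` and `u < a x e`, so `η u < a x
e - a y e`. A union bound over `e` finishes the proof; the gap spares any estimate of differences of
`p`-th powers. -/
lemma volume_separatingSet_le (hp : 0 < p) (hη0 : 0 < η) (hη1 : η < 1) (ha : ∀ x e, 0 ≤ a x e)
    (x y : X) : volume (separatingSet a p η K x y) ≤
      ENNReal.ofReal (∑ e, (|a x e - a y e| / η) ^ p) := by
  refine (measure_mono ?_).trans (volume_exists_coe_le_le _ fun e => by positivity)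
  intro ω hω
  obtain ⟨e, he, he'⟩ := Finset.not_subset.1 hω.2.2
  rw [mem_belowSet] at he he'
  refine ⟨e, ?_⟩
  have hω0 : 0 ≤ (ω e : ℝ) := (ω e).2.1
  obtain ⟨u, hu0, hu⟩ : ∃ u : ℝ, 0 ≤ u ∧ u ^ p = (ω e : ℝ) :=
    ⟨(ω e : ℝ) ^ p⁻¹, by positivity, Real.rpow_inv_rpow hω0 hp.ne'⟩
  rw [← hu] at he he' ⊢
  have h1 : u < a x e := (Real.rpow_lt_rpow_iff hu0 (ha x e) hp).1 he
  have h2 : a y e / (1 - η) ≤ u :=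
    (Real.rpow_le_rpow_iff (div_nonneg (ha y e) (by linarith)) hu0 hp).1 (not_lt.1 he')
  rw [div_le_iff₀ (by linarith)] at h2
  refine Real.rpow_le_rpow hu0 ?_ hp.le
  rw [le_div_iff₀ hη0]
  nlinarith [le_abs_self (a x e - a y e)]

lemma volume_card_belowSet_gt_le_of_sum_le {r : α → ℝ} (hr : ∀ e, 0 ≤ r e) (hK : 0 < K)
    (h : 40 * ∑ e, r e ≤ K) :
    volume {ω | K < (belowSet r ω).card} ≤ ENNReal.ofReal (1 / 40) := by
  refine (volume_card_belowSet_gt_le r hr K hK.ne').trans ?_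
  have hK' : (0 : ℝ) < K := by exact_mod_cast hK
  rw [← ENNReal.ofReal_natCast K, ← ENNReal.ofReal_div_of_pos hK']
  refine ENNReal.ofReal_le_ofReal ?_
  rw [div_le_div_iff₀ hK' (by norm_num)]
  linarith

lemma sum_div_one_sub_rpow_le (hη1 : η < 1) (ha : ∀ x e, 0 ≤ a x e)
    (ha1 : ∀ x, ∑ e, a x e ^ p ≤ 1) (x : X) :
    ∑ e, (a x e / (1 - η)) ^ p ≤ (1 - η) ^ (-p) := by
  have h : ∀ e, (a x e / (1 - η)) ^ p = a x e ^ p * (1 - η) ^ (-p) := fun e => by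
    rw [Real.div_rpow (ha x e) (by linarith), Real.rpow_neg (by linarith), div_eq_mul_inv]
  rw [Finset.sum_congr rfl fun e _ => h e, ← Finset.sum_mul]
  exact mul_le_of_le_one_left (Real.rpow_nonneg (by linarith) _) (ha1 x)

variable [MeasurableSpace X] [Countable X] [DiscreteMeasurableSpace X]

/-- Some coordinate `e` of `x` exceeds its threshold with probability at least `1 - 1/e ≥ 3/5`
(Euler's number). By Fubini `e` is fixed before `y` is drawn, and `a y e = 0` with probability at
least `1/2`. The loss through oversized sets is at most `2/40`, leaving `3/10 - 1/20 = 1/4`. -/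
lemma lintegral_volume_separatingSet_ge (μ : Measure X) [IsProbabilityMeasure μ]
    (hp : 0 < p) (hη0 : 0 < η) (hη1 : η < 1) (ha : ∀ x e, 0 ≤ a x e)
    (ha1 : ∀ x, ∑ e, a x e ^ p ≤ 1) (hμ0 : ∀ e, 1 / 2 ≤ μ {x | a x e = 0})
    (hK : 40 * (1 - η) ^ (-p) ≤ K) {x : X} (hx : 1 ≤ ∑ e, a x e ^ p) :
    ENNReal.ofReal (1 / 4) ≤ ∫⁻ y, volume (separatingSet a p η K x y) ∂μ := by
  have hpow : 1 ≤ (1 - η) ^ (-p) :=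
    Real.one_le_rpow_of_pos_of_le_one_of_nonpos (by linarith) (by linarith) (by linarith)
  have hK0 : 0 < K := by
    have : (0 : ℝ) < K := by linarith
    exact_mod_cast this
  let W : Set (X × (α → unitInterval)) := {q | ∃ e, (q.2 e : ℝ) < a x e ^ p ∧ a q.1 e = 0}
  have hW : MeasurableSet W := by
    have : W = ⋃ y, {y} ×ˢ {ω | belowSet (fun e => a x e ^ p) ω ∈
        {F : Finset α | ∃ e ∈ F, a y e = 0}} := by
      ext q
      simp [W, mem_belowSet]
    rw [this]
    exact MeasurableSet.iUnion fun y =>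
      (measurableSet_singleton y).prod (measurableSet_belowSet_mem _ _)
  have h1 : ∀ y, volume (Prod.mk y ⁻¹' W) ≤
      volume (separatingSet a p η K x y) + ENNReal.ofReal (1 / 20) := by
    intro y
    have hsub : Prod.mk y ⁻¹' W ⊆ separatingSet a p η K x y ∪
        ({ω | K < (belowSet (fun e => a x e ^ p) ω).card} ∪
          {ω | K < (belowSet (fun e => (a y e / (1 - η)) ^ p) ω).card}) := by
      rintro ω ⟨e, he, hy⟩
      by_contra hcon
      simp only [Set.mem_union, Set.mem_ofPred_eq, not_or, not_lt] at hcon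
      refine hcon.1 ⟨hcon.2.1, hcon.2.2, fun hs => ?_⟩
      have := mem_belowSet.1 (hs (mem_belowSet.2 he))
      simp only at hy
      rw [hy, zero_div, Real.zero_rpow hp.ne'] at this
      exact this.not_ge (ω e).2.1
    refine (measure_mono hsub).trans ((measure_union_le _ _).trans ?_)
    gcongr
    refine (measure_union_le _ _).trans ?_
    have e1 := volume_card_belowSet_gt_le_of_sum_le (r := fun e => a x e ^ p)
      (fun e => Real.rpow_nonneg (ha x e) p) hK0 (by linarith [ha1 x])
    have e2 := volume_card_belowSet_gt_le_of_sum_le (r := fun e => (a y e / (1 - η)) ^ p)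
      (fun e => Real.rpow_nonneg (div_nonneg (ha y e) (by linarith)) p) hK0
      (by linarith [sum_div_one_sub_rpow_le hη1 ha ha1 y])
    refine (add_le_add e1 e2).trans_eq ?_
    rw [← ENNReal.ofReal_add (by norm_num) (by norm_num)]
    norm_num
  let H : Set (α → unitInterval) := {ω | ∃ e, (ω e : ℝ) < a x e ^ p}
  have hH : MeasurableSet H := by
    have : H = ⋃ e, {ω | (ω e : ℝ) < a x e ^ p} := by ext; simp [H]
    rw [this]
    exact MeasurableSet.iUnion fun e => measurableSet_coe_apply_lt e _
  have h2 : ENNReal.ofReal (3 / 5) ≤ volume H := by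
    have hc : volume Hᶜ ≤ ENNReal.ofReal (2 / 5) := by
      have : Hᶜ = {ω | ∀ e, a x e ^ p ≤ (ω e : ℝ)} := by ext; simp [H]
      rw [this]
      refine (volume_forall_le_coe_le _).trans (ENNReal.ofReal_le_ofReal ?_)
      have := Real.exp_le_exp.2 (neg_le_neg hx)
      linarith [Real.exp_neg_one_lt_d9]
    rw [← compl_compl H, prob_compl_eq_one_sub hH.compl]
    refine le_trans ?_ (tsub_le_tsub_left hc 1)
    rw [← ENNReal.ofReal_one, ← ENNReal.ofReal_sub _ (by norm_num)]
    norm_num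
  have h3 : ENNReal.ofReal (3 / 10) ≤ ∫⁻ y, volume (Prod.mk y ⁻¹' W) ∂μ := by
    rw [← Measure.prod_apply hW, Measure.prod_apply_symm hW]
    calc ENNReal.ofReal (3 / 10) = 1 / 2 * ENNReal.ofReal (3 / 5) := by
          rw [show (1 / 2 : ℝ≥0∞) = ENNReal.ofReal (1 / 2) by
            rw [ENNReal.ofReal_div_of_pos (by norm_num)]; simp,
            ← ENNReal.ofReal_mul (by norm_num)]
          norm_num
      _ ≤ 1 / 2 * volume H := by gcongr
      _ = ∫⁻ ω, H.indicator (fun _ => 1 / 2) ω := by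
          rw [lintegral_indicator hH, setLIntegral_const]
      _ ≤ _ := by
          refine lintegral_mono fun ω => ?_
          by_cases hω : ω ∈ H
          · rw [Set.indicator_of_mem hω]
            obtain ⟨e, he⟩ := hω
            exact (hμ0 e).trans (measure_mono fun y hy => ⟨e, he, hy⟩)
          · rw [Set.indicator_of_notMem hω]
            exact zero_le
  have h4 := h3.trans (lintegral_mono h1)
  rw [lintegral_add_right _ measurable_const, lintegral_const, measure_univ, mul_one,
    show (3 / 10 : ℝ) = 1 / 4 + 1 / 20 by norm_num,
    ENNReal.ofReal_add (by norm_num) (by norm_num)] at h4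
  exact (ENNReal.add_le_add_iff_right ENNReal.ofReal_ne_top).1 h4

lemma measurableSet_separating :
    MeasurableSet {q : (X × X) × (α → unitInterval) | q.2 ∈ separatingSet a p η K q.1.1 q.1.2} := by
  have : {q : (X × X) × (α → unitInterval) | q.2 ∈ separatingSet a p η K q.1.1 q.1.2} =
      ⋃ z : X × X, {z} ×ˢ separatingSet a p η K z.1 z.2 := by
    ext q
    simp
  rw [this]
  exact MeasurableSet.iUnion fun z =>
    (measurableSet_singleton z).prod (measurableSet_separatingSet _ _)

lemma prod_separating_ge (μ : Measure X) [IsProbabilityMeasure μ]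
    (hp : 0 < p) (hη0 : 0 < η) (hη1 : η < 1) (ha : ∀ x e, 0 ≤ a x e)
    (ha1 : ∀ x, ∑ e, a x e ^ p ≤ 1) (hμ1 : 1 / 2 ≤ μ {x | 1 ≤ ∑ e, a x e ^ p})
    (hμ0 : ∀ e, 1 / 2 ≤ μ {x | a x e = 0}) (hK : 40 * (1 - η) ^ (-p) ≤ K) :
    1 / 8 ≤ ((μ.prod μ).prod volume)
      {q : (X × X) × (α → unitInterval) | q.2 ∈ separatingSet a p η K q.1.1 q.1.2} := by
  rw [Measure.prod_apply measurableSet_separating]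
  change _ ≤ ∫⁻ z : X × X, volume (separatingSet a p η K z.1 z.2) ∂(μ.prod μ)
  rw [lintegral_prod _ Measurable.of_discrete.aemeasurable]
  calc (1 / 8 : ℝ≥0∞) = ENNReal.ofReal (1 / 4) * (1 / 2) := by
        rw [show (1 / 2 : ℝ≥0∞) = ENNReal.ofReal (1 / 2) by
            rw [ENNReal.ofReal_div_of_pos (by norm_num)]; simp,
          ← ENNReal.ofReal_mul (by norm_num), show (1 / 4 * (1 / 2) : ℝ) = 1 / 8 by norm_num,
          ENNReal.ofReal_div_of_pos (by norm_num)]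
        simp
    _ ≤ ENNReal.ofReal (1 / 4) * μ {x | 1 ≤ ∑ e, a x e ^ p} := by gcongr
    _ = ∫⁻ x, {x | 1 ≤ ∑ e, a x e ^ p}.indicator (fun _ => ENNReal.ofReal (1 / 4)) x ∂μ := by
        rw [lintegral_indicator .of_discrete, setLIntegral_const]
    _ ≤ _ := by
        refine lintegral_mono fun x => ?_
        by_cases hx : x ∈ {x | 1 ≤ ∑ e, a x e ^ p}
        · rw [Set.indicator_of_mem hx]
          exact lintegral_volume_separatingSet_ge μ hp hη0 hη1 ha ha1 hμ0 hK hx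
        · rw [Set.indicator_of_notMem hx]
          exact zero_le

end ThresholdSketch

/-! ### Encoding the recorded sets; the two kinds of sketches. -/

/-- A set with at most `K` elements; larger sets are recorded as `none`. -/
def clippedSet {α : Type*} (K : ℕ) (F : Finset α) : Option {F : Finset α // F.card ≤ K} :=
  if h : F.card ≤ K then some ⟨F, h⟩ else none

/-- Two recorded sets certify a separation if the first one is not contained in the second one. -/
def Separates {α : Type*} {K : ℕ} (A B : Option {F : Finset α // F.card ≤ K}) : Prop :=
  ∃ F G, A = some F ∧ B = some G ∧ ¬ F.1 ⊆ G.1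

lemma separates_clippedSet {α : Type*} {K : ℕ} {F G : Finset α} :
    Separates (clippedSet K F) (clippedSet K G) ↔ F.card ≤ K ∧ G.card ≤ K ∧ ¬ F ⊆ G := by
  constructor
  · rintro ⟨A, B, hA, hB, h⟩
    unfold clippedSet at hA hB
    split_ifs at hA hB with h1 h2
    cases hA
    cases hB
    exact ⟨h1, h2, h⟩
  · rintro ⟨h1, h2, h⟩
    exact ⟨⟨F, h1⟩, ⟨G, h2⟩, by simp [clippedSet, h1], by simp [clippedSet, h2], h⟩

lemma card_finset_card_le {α : Type*} [Fintype α] (K : ℕ) :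
    Fintype.card {F : Finset α // F.card ≤ K} ≤ (Fintype.card α + 1) ^ K := by
  classical
  have h : Function.Surjective fun f : {f : Fin K → Option α //
      (Finset.univ.filter fun a => ∃ j, f j = some a).card ≤ K} =>
      (⟨Finset.univ.filter fun a => ∃ j, f.1 j = some a, f.2⟩ :
        {F : Finset α // F.card ≤ K}) := by
    rintro ⟨F, hF⟩
    -- Enumerate `F` and pad the unused slots with `none`.
    let f : Fin K → Option α := fun j =>
      if h : j.1 < F.card then some (F.equivFin.symm ⟨j, h⟩ : α) else none
    have key : (Finset.univ.filter fun a => ∃ j, f j = some a) = F := by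
      ext a
      simp only [Finset.mem_filter, Finset.mem_univ, true_and, f]
      constructor
      · rintro ⟨j, hj⟩
        split_ifs at hj with h
        rw [← Option.some.inj hj]
        exact (F.equivFin.symm ⟨j, h⟩).2
      · intro ha
        refine ⟨⟨F.equivFin ⟨a, ha⟩, (F.equivFin ⟨a, ha⟩).2.trans_le hF⟩, ?_⟩
        simp
    exact ⟨⟨f, by rw [key]; exact hF⟩, Subtype.ext key⟩
  refine (Fintype.card_le_of_surjective _ h).trans ((Fintype.card_subtype_le _).trans ?_)
  simp

section

variable {X α : Type*} [MetricSpace X] [MeasurableSpace X] [Countable X]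
  [DiscreteMeasurableSpace X] [Fintype α]

/-- A map into nonnegative vectors of `ℓ_p` norm at most one for which half of the mass has norm
one, and such that each coordinate vanishes on half of the mass, gives a sketch whose decoder
outputs either `0` or `w`. -/
theorem exists_threshold_sketch (μ : Measure X) [IsProbabilityMeasure μ] {a : X → α → ℝ}
    {p η c : ℝ} {K m s : ℕ} {w : ℝ≥0} (hp : 0 < p) (hη0 : 0 < η) (hη1 : η < 1)
    (ha : ∀ x e, 0 ≤ a x e) (ha1 : ∀ x, ∑ e, a x e ^ p ≤ 1)
    (hμ1 : 1 / 2 ≤ μ {x | 1 ≤ ∑ e, a x e ^ p}) (hμ0 : ∀ e, 1 / 2 ≤ μ {x | a x e = 0})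
    (hK : 40 * (1 - η) ^ (-p) ≤ K) (hm : 0 < m)
    (hclose : ∀ x y, dist x y < w → ∑ e, (|a x e - a y e| / η) ^ p ≤ (1 / 2) ^ 17)
    (hw : ∀ x y : X, x ≠ y → w * (1 / 2) ^ m ≤ dist x y)
    (hM : (ENNReal.ofReal c)⁻¹ * ∫⁻ z, edist z.1 z.2 ∂(μ.prod μ) ≤ w * (1 / 16))
    (hs : ((Fintype.card α + 1) ^ K + 1) ^ (32 * m) ≤ 2 ^ s) :
    ∃ D : Measure (SketchPair X s), IsAvgDistortionSketch μ c D ∧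
      ∀ x y : X, ENNReal.ofReal (1 - (1 / 2) ^ m) ≤ D {t | (t.output x y : ℝ) ≤ dist x y} := by
  classical
  let T := Option {F : Finset α // F.card ≤ K}
  let S := Fin (16 * m) → T × T
  have hS : Fintype.card S ≤ 2 ^ s := by
    refine le_trans ?_ hs
    have h : Fintype.card S = (Fintype.card {F : Finset α // F.card ≤ K} + 1) ^ (32 * m) := by
      simp only [S, T, Fintype.card_pi_const, Fintype.card_prod, Fintype.card_option]
      rw [← sq, ← pow_mul]
      congr 1
      ring
    rw [h]
    gcongr
    exact card_finset_card_le K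
  let sk : (Fin (16 * m) → α → unitInterval) → X → S := fun ω x j =>
    (clippedSet K (belowSet (fun e => a x e ^ p) (ω j)),
      clippedSet K (belowSet (fun e => (a x e / (1 - η)) ^ p) (ω j)))
  have hsk : ∀ x t, MeasurableSet {ω | sk ω x = t} := by
    intro x t
    have : {ω | sk ω x = t} = ⋂ j, (fun ω : Fin (16 * m) → α → unitInterval => ω j) ⁻¹'
        ({u | belowSet (fun e => a x e ^ p) u ∈ {F | clippedSet K F = (t j).1}} ∩
          {u | belowSet (fun e => (a x e / (1 - η)) ^ p) u ∈
            {F | clippedSet K F = (t j).2}}) := by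
      ext ω
      simp only [Set.mem_ofPred_eq, Set.mem_iInter, Set.mem_preimage, Set.mem_inter_iff]
      exact ⟨fun h j => by simp [← h, sk], fun h => funext fun j => Prod.ext (h j).1 (h j).2⟩
    rw [this]
    exact MeasurableSet.iInter fun j => (measurable_pi_apply j)
      ((measurableSet_belowSet_mem _ _).inter (measurableSet_belowSet_mem _ _))
  let alg : S → S → ℝ≥0 := fun u v =>
    if m ≤ (Finset.univ.filter fun j => Separates (u j).1 (v j).2).card then w else 0
  let E : X → X → Set (Fin (16 * m) → α → unitInterval) := fun x y =>
    {ω | m ≤ hitCount (separatingSet a p η K x y) ω}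
  have hE : ∀ x y, MeasurableSet (E x y) := fun x y =>
    measurableSet_hitCount_ge (measurableSet_separatingSet x y) _ m
  have halg : ∀ ω x y, alg (sk ω x) (sk ω y) = if ω ∈ E x y then w else 0 := by
    intro ω x y
    have hcard : (Finset.univ.filter fun j => Separates (sk ω x j).1 (sk ω y j).2).card =
        hitCount (separatingSet a p η K x y) ω := by
      unfold hitCount
      congr 1
      ext j
      have hj : Separates (sk ω x j).1 (sk ω y j).2 ↔ ω j ∈ separatingSet a p η K x y :=
        separates_clippedSet
      rw [Finset.mem_filter, Finset.mem_filter, hj]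
    simp only [alg, hcard]
    rfl
  have hlint : ∀ x y, ∫⁻ ω, (alg (sk ω x) (sk ω y) : ℝ≥0∞) = w * volume (E x y) := by
    intro x y
    rw [← lintegral_indicator_one (hE x y), ← lintegral_const_mul _
      (measurable_one.indicator (hE x y))]
    refine lintegral_congr fun ω => ?_
    rw [halg]
    by_cases h : ω ∈ E x y <;> simp [h]
  -- The exponent 17 beats the `2^{16m}` choices of successful trials: `2^{16m} * 2^{-17m} =
  -- 2^{-m}`.
  have hfar : ∀ x y, dist x y < w → volume (E x y) ≤ ENNReal.ofReal ((1 / 2) ^ m) := by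
    intro x y hxy
    refine (pi_hitCount_ge_le volume _ _ m).trans ?_
    have h1 : volume (separatingSet a p η K x y) ≤ ENNReal.ofReal ((1 / 2) ^ 17) :=
      (volume_separatingSet_le hp hη0 hη1 ha x y).trans (ENNReal.ofReal_le_ofReal (hclose x y hxy))
    calc (2 : ℝ≥0∞) ^ (16 * m) * volume (separatingSet a p η K x y) ^ m
        ≤ ENNReal.ofReal (2 ^ (16 * m)) * ENNReal.ofReal ((1 / 2) ^ 17) ^ m := by
          gcongr
          rw [ENNReal.ofReal_pow (by norm_num)]
          simp
      _ = ENNReal.ofReal ((1 / 2) ^ m) := by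
          rw [← ENNReal.ofReal_pow (by positivity), ← ENNReal.ofReal_mul (by positivity),
            pow_mul, ← mul_pow]
          norm_num
  have hself : ∀ x, E x x = ∅ := by
    intro x
    refine Set.eq_empty_of_forall_notMem fun ω (hω : m ≤ _) => ?_
    rw [separatingSet_self hp.le hη0.le hη1 ha] at hω
    simp [hitCount, hm.ne'] at hω
  -- Below distance `w`, the output `w` occurs with probability at most `2^{-m}`, and `w * 2^{-m}`
  -- is at most any positive distance; from `w` on, outputting `w` is harmless.
  have hne : ∀ x y, ∫⁻ ω, (alg (sk ω x) (sk ω y) : ℝ≥0∞) ≤ edist x y := by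
    intro x y
    rw [hlint, edist_dist]
    rcases eq_or_ne x y with rfl | hne
    · simp [hself]
    have hwr : (w : ℝ≥0∞) = ENNReal.ofReal w := by simp
    by_cases hxy : dist x y < w
    · calc (w : ℝ≥0∞) * volume (E x y) ≤ ENNReal.ofReal w * ENNReal.ofReal ((1 / 2) ^ m) := by
            rw [hwr]
            gcongr
            exact hfar x y hxy
        _ = ENNReal.ofReal (w * (1 / 2) ^ m) := (ENNReal.ofReal_mul w.2).symm
        _ ≤ _ := ENNReal.ofReal_le_ofReal (hw x y hne)
    · calc (w : ℝ≥0∞) * volume (E x y) ≤ w * 1 := by gcongr; exact prob_le_one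
        _ = ENNReal.ofReal w := by rw [mul_one, hwr]
        _ ≤ _ := ENNReal.ofReal_le_ofReal (not_lt.1 hxy)
  have hbc : (ENNReal.ofReal c)⁻¹ * ∫⁻ z, edist z.1 z.2 ∂(μ.prod μ) ≤
      ∫⁻ z, ∫⁻ ω, (alg (sk ω z.1) (sk ω z.2) : ℝ≥0∞) ∂volume ∂(μ.prod μ) := by
    refine hM.trans ?_
    have hmeas := measurableSet_separating (X := X) (α := α) (a := a) (p := p) (η := η) (K := K)
    have h1 := prod_pi_hitCount_ge (μ.prod μ) (volume : Measure (α → unitInterval)) hmeas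
      (prod_separating_ge μ hp hη0 hη1 ha ha1 hμ1 hμ0 hK) hm
    rw [Measure.prod_apply (measurableSet_hitCount_section_ge hmeas _ m)] at h1
    simp only [hlint]
    rw [lintegral_const_mul _ Measurable.of_discrete]
    gcongr
    exact h1
  obtain ⟨D, hD, hprob⟩ := exists_sketch_of_random_map hS hsk hne hbc
  refine ⟨D, hD, fun x y => ?_⟩
  rw [hprob]
  by_cases hxy : dist x y < w
  · have hsub : (E x y)ᶜ ⊆ {ω | (alg (sk ω x) (sk ω y) : ℝ) ≤ dist x y} := by
      intro ω hω
      have h0 : alg (sk ω x) (sk ω y) = 0 := by rw [halg, if_neg hω]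
      simp [h0]
    refine le_trans ?_ (measure_mono hsub)
    rw [prob_compl_eq_one_sub (hE x y), ENNReal.ofReal_sub _ (by positivity),
      ENNReal.ofReal_one]
    exact tsub_le_tsub_left (hfar x y hxy) 1
  · have huniv : {ω | (alg (sk ω x) (sk ω y) : ℝ) ≤ dist x y} = Set.univ := by
      refine Set.eq_univ_of_forall fun ω => ?_
      change (alg (sk ω x) (sk ω y) : ℝ) ≤ dist x y
      rw [halg]
      split_ifs
      · exact not_lt.1 hxy
      · simp
    rw [huniv, measure_univ, ← ENNReal.ofReal_one]
    exact ENNReal.ofReal_le_ofReal (by linarith [pow_pos (show (0 : ℝ) < 1 / 2 by norm_num) m])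

end

/-- A function into an initial segment of `ℕ` gives a deterministic sketch. -/
lemma exists_sketch_of_nat_valued {X : Type*} [MetricSpace X] [MeasurableSpace X] [Countable X]
    [DiscreteMeasurableSpace X] (μ : Measure X) [IsProbabilityMeasure μ] (h : X → ℕ) {B s : ℕ}
    (hB : ∀ x, h x ≤ B) (hs : B + 1 ≤ 2 ^ s)
    (hlip : ∀ x y, |(h x : ℝ) - h y| / 2 ≤ dist x y) {c : ℝ}
    (hM : (ENNReal.ofReal c)⁻¹ * ∫⁻ z, edist z.1 z.2 ∂(μ.prod μ) ≤
      ∫⁻ z, ENNReal.ofReal (|(h z.1 : ℝ) - h z.2| / 2) ∂(μ.prod μ)) :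
    ∃ D : Measure (SketchPair X s), IsAvgDistortionSketch μ c D ∧
      ∀ x y : X, D {t | (t.output x y : ℝ) ≤ dist x y} = 1 := by
  let sk : Unit → X → Fin (B + 1) := fun _ x => ⟨h x, Nat.lt_succ_of_le (hB x)⟩
  let alg : Fin (B + 1) → Fin (B + 1) → ℝ≥0 := fun u v => (|(u : ℝ) - v| / 2).toNNReal
  have halg : ∀ ω x y, (alg (sk ω x) (sk ω y) : ℝ) = |(h x : ℝ) - h y| / 2 := fun ω x y =>
    Real.coe_toNNReal _ (by positivity)
  have halg' : ∀ ω x y, (alg (sk ω x) (sk ω y) : ℝ≥0∞) =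
      ENNReal.ofReal (|(h x : ℝ) - h y| / 2) := fun ω x y => rfl
  obtain ⟨D, hD, hprob⟩ := exists_sketch_of_random_map (μ := μ) (c := c) (s := s)
    (P := Measure.dirac ()) (sk := sk) (alg := alg) (by simpa using hs)
    (fun _ _ => .of_discrete)
    (fun x y => by
      simp only [halg', lintegral_dirac]
      rw [edist_dist]
      exact ENNReal.ofReal_le_ofReal (hlip x y))
    (by simpa only [halg', lintegral_dirac] using hM)
  refine ⟨D, hD, fun x y => ?_⟩
  rw [hprob]
  simp [halg, hlip]

/-- The radial projection to a ball is `2`-Lipschitz. -/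
lemma norm_inv_max_smul_sub_le {E : Type*} [NormedAddCommGroup E] [NormedSpace ℝ E] {ρ : ℝ}
    (hρ : 0 < ρ) (x y : E) :
    ‖(max ρ ‖x‖)⁻¹ • x - (max ρ ‖y‖)⁻¹ • y‖ ≤ 2 * ‖x - y‖ / ρ := by
  set A := max ρ ‖x‖ with hA
  set B := max ρ ‖y‖ with hB
  have hAρ : ρ ≤ A := le_max_left _ _
  have hBρ : ρ ≤ B := le_max_left _ _
  have hA0 : 0 < A := hρ.trans_le hAρ
  have hB0 : 0 < B := hρ.trans_le hBρ
  have hAB : |B - A| ≤ ‖x - y‖ := by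
    rw [hA, hB, abs_sub_comm, max_comm ρ, max_comm ρ]
    exact (abs_max_sub_max_le_abs _ _ _).trans (abs_norm_sub_norm_le x y)
  have hy : ‖B⁻¹ • y‖ ≤ 1 := by
    rw [norm_smul, norm_inv, Real.norm_of_nonneg hB0.le, inv_mul_le_one₀ hB0]
    exact le_max_right _ _
  -- Both terms in the bracket have norm at most `‖x - y‖`, since `B⁻¹ • y` lies in the unit ball.
  have heq : A⁻¹ • x - B⁻¹ • y = A⁻¹ • ((x - y) + (B - A) • (B⁻¹ • y)) := by
    rw [smul_add, smul_sub, smul_smul, smul_smul, show A⁻¹ * (B - A) * B⁻¹ = A⁻¹ - B⁻¹ by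
      field_simp, sub_smul]
    abel
  rw [heq, norm_smul, norm_inv, Real.norm_of_nonneg hA0.le]
  have h1 : ‖(x - y) + (B - A) • (B⁻¹ • y)‖ ≤ 2 * ‖x - y‖ := by
    refine (norm_add_le _ _).trans ?_
    rw [norm_smul, Real.norm_eq_abs]
    nlinarith [norm_nonneg (B⁻¹ • y), abs_nonneg (B - A)]
  calc A⁻¹ * ‖(x - y) + (B - A) • (B⁻¹ • y)‖ ≤ ρ⁻¹ * (2 * ‖x - y‖) := by gcongr
    _ = _ := by ring

/-! ### Norms and signed parts in `ℓ_p`. -/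

section Lp

variable {p : ℝ≥0∞} [Fact (1 ≤ p)] {ι : Type*} [Fintype ι]

lemma one_le_toReal (hp : p ≠ ∞) : 1 ≤ p.toReal := by
  simpa using ENNReal.toReal_mono hp (Fact.out : 1 ≤ p)

lemma norm_rpow_eq_sum (hp : p ≠ ∞) (v : PiLp p fun _ : ι => ℝ) :
    ‖v‖ ^ p.toReal = ∑ i, |v i| ^ p.toReal := by
  have h := one_le_toReal hp
  rw [PiLp.norm_eq_sum (by linarith), ← Real.rpow_mul (by positivity)]
  simp [show p.toReal ≠ 0 by linarith]

/-- The crude factor `n` in place of `n^{1/p}` suffices, as the bound enters the sketch size only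
through its logarithm. -/
lemma norm_le_card_mul (hp : p ≠ ∞) (v : PiLp p fun _ : ι => ℝ) {b : ℝ} (hb : 0 ≤ b)
    (h : ∀ i, |v i| ≤ b) : ‖v‖ ≤ Fintype.card ι * b := by
  have hp1 := one_le_toReal hp
  rw [← Real.rpow_le_rpow_iff (norm_nonneg v) (by positivity) (show 0 < p.toReal by linarith),
    norm_rpow_eq_sum hp, Real.mul_rpow (by positivity) hb]
  calc ∑ i, |v i| ^ p.toReal ≤ ∑ _i : ι, b ^ p.toReal := by
        gcongr with i
        exact h i
    _ = Fintype.card ι * b ^ p.toReal := by simp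
    _ ≤ _ := by
        gcongr
        rcases Nat.eq_zero_or_pos (Fintype.card ι) with h0 | h0
        · simp [h0, Real.rpow_nonneg]
        · exact Real.self_le_rpow_of_one_le (by exact_mod_cast h0) hp1

lemma eq_zero_or_one_le_norm (v : PiLp p fun _ : ι => ℝ) (h : ∀ i, ∃ n : ℤ, v i = n) :
    v = 0 ∨ 1 ≤ ‖v‖ := by
  by_cases h0 : ∀ i, v i = 0
  · exact Or.inl (by ext i; exact h0 i)
  · push Not at h0
    obtain ⟨i, hi⟩ := h0
    obtain ⟨n, hn⟩ := h i
    refine Or.inr (le_trans ?_ (PiLp.norm_apply_le v i))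
    have hn0 : n ≠ 0 := fun h0 => hi (by simp [hn, h0])
    rw [hn, Real.norm_eq_abs]
    exact_mod_cast Int.one_le_abs hn0

/-- The vector of positive parts and negative parts of the coordinates of `v`. -/
noncomputable def signedParts {p : ℝ≥0∞} {ι : Type*} (v : PiLp p fun _ : ι => ℝ) (e : ι × Bool) : ℝ :=
  max (if e.2 then v e.1 else -v e.1) 0

lemma signedParts_nonneg {p : ℝ≥0∞} {ι : Type*} (v : PiLp p fun _ : ι => ℝ) (e : ι × Bool) : 0 ≤ signedParts v e :=
  le_max_right _ _

lemma sum_signedParts_rpow (hp : p ≠ ∞) (v : PiLp p fun _ : ι => ℝ) :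
    ∑ e, signedParts v e ^ p.toReal = ‖v‖ ^ p.toReal := by
  have h := one_le_toReal hp
  have h0 : p.toReal ≠ 0 := by linarith
  rw [norm_rpow_eq_sum hp, Fintype.sum_prod_type]
  refine Finset.sum_congr rfl fun i _ => ?_
  rw [Fintype.sum_bool]
  rcases le_total 0 (v i) with hi | hi
  · simp [signedParts, hi, abs_of_nonneg hi, Real.zero_rpow h0]
  · simp [signedParts, hi, abs_of_nonpos hi, Real.zero_rpow h0]

lemma abs_signedParts_sub_le {p : ℝ≥0∞} {ι : Type*} (v w : PiLp p fun _ : ι => ℝ) (e : ι × Bool) :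
    |signedParts v e - signedParts w e| ≤ |v e.1 - w e.1| := by
  refine (abs_max_sub_max_le_abs _ _ _).trans ?_
  split_ifs
  · exact le_rfl
  · rw [← abs_neg]
    exact le_of_eq (by congr 1; ring)

lemma sum_abs_signedParts_sub_rpow_le (hp : p ≠ ∞) (v w : PiLp p fun _ : ι => ℝ) {η : ℝ}
    (hη : 0 < η) : ∑ e, (|signedParts v e - signedParts w e| / η) ^ p.toReal ≤
      2 * (‖v - w‖ / η) ^ p.toReal := by
  have h := one_le_toReal hp
  rw [Real.div_rpow (norm_nonneg _) hη.le, norm_rpow_eq_sum hp, Finset.sum_div, Finset.mul_sum,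
    Fintype.sum_prod_type]
  refine Finset.sum_le_sum fun i _ => ?_
  rw [Fintype.sum_bool, two_mul, PiLp.sub_apply, ← Real.div_rpow (abs_nonneg _) hη.le]
  refine add_le_add ?_ ?_ <;>
    exact Real.rpow_le_rpow (by positivity)
      (div_le_div_of_nonneg_right (abs_signedParts_sub_le v w _) hη.le) (by linarith)

end Lp

/-! ### Integer points with median at the origin. -/

section Centered

variable {p : ℝ≥0∞} [Fact (1 ≤ p)] {ι : Type*} [Fintype ι]
  {X : Type*} [MetricSpace X] [MeasurableSpace X] [Countable X] [DiscreteMeasurableSpace X]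

/-- Rounding costs at most 1, which is at most the distance of distinct points; halving absorbs it.
-/
lemma abs_ceil_norm_sub_sub_le {v w : PiLp p fun _ : ι => ℝ} (h : v - w = 0 ∨ 1 ≤ ‖v - w‖) (R : ℕ) :
    |((⌈‖v‖⌉₊ - R : ℕ) : ℝ) - ((⌈‖w‖⌉₊ - R : ℕ) : ℝ)| / 2 ≤ ‖v - w‖ := by
  rcases h with h | h
  · rw [sub_eq_zero] at h
    simp [h]
  have key : ∀ v w : PiLp p fun _ : ι => ℝ,
      ((⌈‖v‖⌉₊ - R : ℕ) : ℝ) ≤ ((⌈‖w‖⌉₊ - R : ℕ) : ℝ) + (‖v - w‖ + 1) := by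
    intro v w
    have h1 : ‖v‖ ≤ ‖w‖ + ‖v - w‖ := by
      have := norm_sub_norm_le v w
      linarith
    have h2 := Nat.ceil_lt_add_one (norm_nonneg v)
    have h3 := Nat.le_ceil ‖w‖
    have h4 : (⌈‖w‖⌉₊ : ℝ) ≤ ((⌈‖w‖⌉₊ - R : ℕ) : ℝ) + R := by
      exact_mod_cast (by omega : ⌈‖w‖⌉₊ ≤ ⌈‖w‖⌉₊ - R + R)
    rcases le_total ⌈‖v‖⌉₊ R with h5 | h5
    · rw [Nat.sub_eq_zero_of_le h5]
      have := norm_nonneg (v - w)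
      push_cast
      positivity
    · rw [Nat.cast_sub h5]
      linarith
  have h1 := key v w
  have h2 := key w v
  rw [norm_sub_rev w v] at h2
  rw [div_le_iff₀ (by norm_num), abs_le]
  constructor <;> linarith

/-- A sketch for integer points in `ℓ_p` whose coordinatewise median is the origin. -/
theorem exists_sketch_of_coordinatewise_median_zero (hp : p ≠ ∞) (μ : Measure X)
    [IsProbabilityMeasure μ] {v : X → PiLp p fun _ : ι => ℝ}
    (hdist : ∀ x y, dist x y = ‖v x - v y‖) (hint : ∀ x i, ∃ n : ℤ, v x i = n)
    (hpos : ∀ i, 1 / 2 ≤ μ {x | 0 ≤ v x i}) (hneg : ∀ i, 1 / 2 ≤ μ {x | v x i ≤ 0})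
    {B K m s : ℕ} (hB : ∀ x, ‖v x‖ ≤ B) (hBm : B ≤ 2 ^ m) (hm : 0 < m) {c η : ℝ}
    (hη0 : 0 < η) (hη1 : η < 1) (hc : 2 ^ 26 ≤ c * η)
    (hK : 40 * (1 - η) ^ (-p.toReal) ≤ K)
    (hs : ((2 * Fintype.card ι + 1) ^ K + 1) ^ (32 * m) ≤ 2 ^ s) (hBs : B + 1 ≤ 2 ^ s) :
    ∃ D : Measure (SketchPair X s), IsAvgDistortionSketch μ c D ∧
      ∀ x y : X, ENNReal.ofReal (1 - (1 / 2) ^ m) ≤ D {t | (t.output x y : ℝ) ≤ dist x y} := by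
  have hp1 := one_le_toReal hp
  have hc0 : 2 ^ 26 ≤ c := by
    have : 0 < c := by
      by_contra! hcon
      nlinarith
    nlinarith
  have hsep : ∀ x y, v x - v y = 0 ∨ 1 ≤ ‖v x - v y‖ := by
    intro x y
    refine eq_zero_or_one_le_norm _ fun i => ?_
    obtain ⟨n, hn⟩ := hint x i
    obtain ⟨k, hk⟩ := hint y i
    exact ⟨n - k, by simp [hn, hk]⟩
  let g : X → ℕ := fun x => ⌈‖v x‖⌉₊
  have hgB : ∀ x, g x ≤ B := fun x => Nat.ceil_le.2 (hB x)
  obtain ⟨R, hRB, hR1, hR2⟩ := exists_nat_median μ g hgB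
  let h : X → ℕ := fun x => g x - R
  let J : ℝ≥0∞ := ∫⁻ x, (h x : ℝ≥0∞) ∂μ
  have hM : ∫⁻ z, edist z.1 z.2 ∂(μ.prod μ) ≤ 2 * (R + J) := by
    rw [lintegral_prod _ Measurable.of_discrete.aemeasurable]
    have hle : ∀ x y : X, edist x y ≤ (R + (h x : ℝ≥0∞)) + (R + (h y : ℝ≥0∞)) := by
      intro x y
      have hb : ∀ x, ‖v x‖ ≤ R + h x := fun x => by
        refine (Nat.le_ceil _).trans ?_
        exact_mod_cast (by simp only [h, g]; omega : ⌈‖v x‖⌉₊ ≤ R + h x)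
      rw [edist_dist, hdist]
      calc ENNReal.ofReal ‖v x - v y‖
          ≤ ENNReal.ofReal (((R + h x + (R + h y) : ℕ) : ℝ)) := by
            refine ENNReal.ofReal_le_ofReal ((norm_sub_le _ _).trans ?_)
            push_cast
            exact add_le_add (hb x) (hb y)
        _ = _ := by
            rw [ENNReal.ofReal_natCast]
            push_cast
            rfl
    calc ∫⁻ x, ∫⁻ y, edist x y ∂μ ∂μ
        ≤ ∫⁻ x, ∫⁻ y, ((R + (h x : ℝ≥0∞)) + (R + (h y : ℝ≥0∞))) ∂μ ∂μ :=
          lintegral_mono fun x => lintegral_mono fun y => hle x y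
      _ = 2 * (R + J) := by
          have hf : ∫⁻ x, (R + (h x : ℝ≥0∞)) ∂μ = R + J := by
            rw [lintegral_add_left measurable_const, lintegral_const, measure_univ, mul_one]
          have hx : ∀ x, ∫⁻ y, ((R + (h x : ℝ≥0∞)) + (R + (h y : ℝ≥0∞))) ∂μ =
              (R + (h x : ℝ≥0∞)) + (R + J) := fun x => by
            rw [lintegral_add_left measurable_const, lintegral_const, measure_univ, mul_one, hf]
          simp only [hx]
          rw [lintegral_add_right _ measurable_const, lintegral_const, measure_univ, mul_one, hf,
            two_mul]
  have hcinv : (ENNReal.ofReal c)⁻¹ = ENNReal.ofReal c⁻¹ :=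
    (ENNReal.ofReal_inv_of_pos (by linarith)).symm
  rcases le_or_gt (R : ℝ≥0∞) J with hRJ | hRJ
  -- Norm-dominated case: `h y = 0` for half of the `y`, where the difference is all of `h x`.
  · have hJ : J / 2 ≤ ∫⁻ z, ENNReal.ofReal |(h z.1 : ℝ) - h z.2| ∂(μ.prod μ) := by
      rw [lintegral_prod _ Measurable.of_discrete.aemeasurable, div_eq_mul_inv,
        ← lintegral_mul_const _ Measurable.of_discrete]
      refine lintegral_mono fun x => ?_
      calc (h x : ℝ≥0∞) * 2⁻¹ ≤ h x * μ {y | g y ≤ R} := by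
            gcongr
            simpa using hR1
        _ = ∫⁻ y, {y | g y ≤ R}.indicator (fun _ => (h x : ℝ≥0∞)) y ∂μ := by
            rw [lintegral_indicator .of_discrete, setLIntegral_const]
        _ ≤ _ := by
            refine lintegral_mono fun y => ?_
            by_cases hy : g y ≤ R
            · rw [Set.indicator_of_mem (by exact hy)]
              have : h y = 0 := Nat.sub_eq_zero_of_le hy
              simp [this]
            · rw [Set.indicator_of_notMem (by exact hy)]
              exact zero_le
    obtain ⟨D, hD, hprob⟩ := exists_sketch_of_nat_valued μ h (c := c)
      (fun x => (Nat.sub_le _ _).trans (hgB x)) hBs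
      (fun x y => by
        rw [hdist]
        exact abs_ceil_norm_sub_sub_le (hsep x y) R) (by
        have h1 : ∀ z : X × X, ENNReal.ofReal (|(h z.1 : ℝ) - h z.2| / 2) =
            2⁻¹ * ENNReal.ofReal |(h z.1 : ℝ) - h z.2| := fun z => by
          rw [ENNReal.ofReal_div_of_pos (by norm_num), mul_comm, div_eq_mul_inv]
          simp
        simp only [h1]
        rw [lintegral_const_mul _ Measurable.of_discrete]
        calc (ENNReal.ofReal c)⁻¹ * ∫⁻ z, edist z.1 z.2 ∂(μ.prod μ)
            ≤ ENNReal.ofReal (1 / 16) * (2 * (J + J)) := by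
              rw [hcinv]
              refine mul_le_mul' (ENNReal.ofReal_le_ofReal ?_) (hM.trans (by gcongr))
              rw [one_div]
              exact inv_anti₀ (by norm_num) (by linarith)
          _ = ENNReal.ofReal (1 / 4) * J := by
              rw [← two_mul, ← mul_assoc, ← mul_assoc, show (2 : ℝ≥0∞) = ENNReal.ofReal 2 by simp,
                ← ENNReal.ofReal_mul (by norm_num), ← ENNReal.ofReal_mul (by norm_num)]
              norm_num
          _ = 2⁻¹ * (J / 2) := by
              rw [ENNReal.div_eq_inv_mul, ← mul_assoc, show (2⁻¹ : ℝ≥0∞) = ENNReal.ofReal 2⁻¹ by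
                rw [ENNReal.ofReal_inv_of_pos (by norm_num)]; simp,
                ← ENNReal.ofReal_mul (by norm_num)]
              norm_num
          _ ≤ _ := by gcongr)
    refine ⟨D, hD, fun x y => ?_⟩
    rw [hprob, ← ENNReal.ofReal_one]
    exact ENNReal.ofReal_le_ofReal (by linarith [pow_pos (show (0 : ℝ) < 1 / 2 by norm_num) m])
  · have hR0 : 0 < R := by
      rcases Nat.eq_zero_or_pos R with h0 | h0
      · simp [h0] at hRJ
      · exact h0
    have hR0' : (1 : ℝ) ≤ R := by exact_mod_cast hR0
    -- Half of `R` compensates the rounding: a rounded norm at least `R` forces a norm at least `max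
    -- 1 (R - 1) ≥ R / 2`, so half of the mass reaches the unit sphere.
    set ρ : ℝ := R / 2 with hρ
    have hρ0 : 0 < ρ := by positivity
    let u : X → PiLp p fun _ : ι => ℝ := fun x => (max ρ ‖v x‖)⁻¹ • v x
    have hmax : ∀ x, 0 < max ρ ‖v x‖ := fun x => lt_max_of_lt_left hρ0
    have hu : ∀ x, ‖u x‖ = ‖v x‖ / max ρ ‖v x‖ := fun x => by
      simp only [u]
      rw [norm_smul, norm_inv, Real.norm_of_nonneg (hmax x).le, div_eq_inv_mul]
    have hzero : ∀ x e, (if e.2 then v x e.1 else -v x e.1) ≤ 0 → signedParts (u x) e = 0 := by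
      intro x e he
      refine max_eq_right ?_
      have h1 : (if e.2 then u x e.1 else -u x e.1) =
          (max ρ ‖v x‖)⁻¹ * (if e.2 then v x e.1 else -v x e.1) := by
        split_ifs <;> simp [u]
      rw [h1]
      exact mul_nonpos_of_nonneg_of_nonpos (inv_nonneg.2 (hmax x).le) he
    -- Distances below `w` become at most `2^{-18} η` under the `2/ρ`-Lipschitz projection, giving
    -- separation probability at most `2 * 2^{-18}`. The mean distance is at most `4R = 8ρ`, and
    -- `8ρ/c ≤ w/16` is exactly `2^26 ≤ c * η`.
    let w : ℝ≥0 := ⟨(1 / 2) ^ 19 * η * ρ, by positivity⟩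
    have hw : (w : ℝ) = (1 / 2) ^ 19 * η * ρ := rfl
    refine exists_threshold_sketch μ (a := fun x => signedParts (u x)) (p := p.toReal) (w := w)
      (K := K) (by linarith) hη0 hη1 (fun x e => signedParts_nonneg _ e) (fun x => ?_) ?_
      (fun e => ?_) hK hm (fun x y hxy => ?_) (fun x y hxy => ?_) ?_ ?_
    · rw [sum_signedParts_rpow hp]
      refine Real.rpow_le_one (norm_nonneg _) ?_ (by linarith)
      rw [hu]
      exact div_le_one_of_le₀ (le_max_right _ _) (hmax x).le
    · refine hR2.trans (measure_mono fun x hx => ?_)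
      change 1 ≤ ∑ e, signedParts (u x) e ^ p.toReal
      have hx' : R ≤ ⌈‖v x‖⌉₊ := hx
      have h1 : 1 ≤ ‖v x‖ := by
        rcases eq_zero_or_one_le_norm (v x) (hint x) with h0 | h0
        · simp [h0] at hx'
          omega
        · exact h0
      have h2 : (R : ℝ) ≤ ⌈‖v x‖⌉₊ := by exact_mod_cast hx'
      have h3 := Nat.ceil_lt_add_one (norm_nonneg (v x))
      rw [sum_signedParts_rpow hp, hu, max_eq_right (by rw [hρ]; linarith),
        div_self (by linarith), Real.one_rpow]
    · rcases e with ⟨i, _ | _⟩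
      · refine (hpos i).trans (measure_mono fun x hx => hzero x _ ?_)
        have hx' : 0 ≤ v x i := hx
        simpa using hx'
      · refine (hneg i).trans (measure_mono fun x hx => hzero x _ ?_)
        have hx' : v x i ≤ 0 := hx
        simpa using hx'
    · refine (sum_abs_signedParts_sub_rpow_le hp _ _ hη0).trans ?_
      have h1 : ‖u x - u y‖ / η ≤ (1 / 2) ^ 18 := by
        rw [div_le_iff₀ hη0]
        refine (norm_inv_max_smul_sub_le hρ0 (v x) (v y)).trans ?_
        rw [div_le_iff₀ hρ0, ← hdist]
        rw [hw] at hxy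
        linarith
      calc 2 * (‖u x - u y‖ / η) ^ p.toReal ≤ 2 * ((1 / 2 : ℝ) ^ 18) ^ p.toReal := by gcongr
        _ ≤ 2 * (1 / 2 : ℝ) ^ 18 := by
          gcongr
          exact Real.rpow_le_self_of_le_one (by positivity) (by norm_num) hp1
        _ ≤ _ := by norm_num
    · have h1 : 1 ≤ dist x y := by
        rw [hdist]
        refine (hsep x y).resolve_left fun h0 => hxy ?_
        rw [← dist_eq_zero, hdist, h0, norm_zero]
      have h2 : (w : ℝ) ≤ 2 ^ m := by
        have h3 : (R : ℝ) ≤ 2 ^ m := by exact_mod_cast hRB.trans hBm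
        have h4 : (1 / 2 : ℝ) ^ 19 * η ≤ 1 := by
          have : (1 / 2 : ℝ) ^ 19 ≤ 1 := by norm_num
          nlinarith
        rw [hw, hρ]
        nlinarith
      calc (w : ℝ) * (1 / 2) ^ m ≤ 2 ^ m * (1 / 2) ^ m := by gcongr
        _ = 1 := by rw [← mul_pow]; norm_num
        _ ≤ _ := h1
    · calc (ENNReal.ofReal c)⁻¹ * ∫⁻ z, edist z.1 z.2 ∂(μ.prod μ)
          ≤ (ENNReal.ofReal c)⁻¹ * (2 * (R + R)) := by
            gcongr
            exact hM.trans (by gcongr)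
        _ = ENNReal.ofReal (c⁻¹ * (8 * ρ)) := by
            rw [hcinv, ENNReal.ofReal_mul (by positivity)]
            congr 1
            rw [hρ, show (8 * ((R : ℝ) / 2)) = ((2 * (R + R) : ℕ) : ℝ) by push_cast; ring,
              ENNReal.ofReal_natCast]
            push_cast
            rfl
        _ ≤ ENNReal.ofReal (w * (1 / 16)) := by
            refine ENNReal.ofReal_le_ofReal ?_
            rw [hw, inv_mul_le_iff₀ (by linarith)]
            nlinarith
        _ = w * (1 / 16) := by
            rw [ENNReal.ofReal_mul w.coe_nonneg, ENNReal.ofReal_div_of_pos (by norm_num)]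
            simp
    · rw [Fintype.card_prod, Fintype.card_bool, mul_comm _ 2]
      exact hs

end Centered

/-! ### Centering the grid. -/

section Grid

variable {p : ℝ≥0∞} {d Δ : ℕ}

instance finite_lpGrid : Finite (lpGrid p d Δ) := by
  choose n hn using fun x : lpGrid p d Δ => x.2
  refine Finite.of_injective
    (fun (x : lpGrid p d Δ) (i : Fin d) => (⟨n x i, Nat.lt_succ_of_le (hn x i).2.1⟩ : Fin (Δ + 1)))
    fun x y hxy => Subtype.ext ?_
  ext i
  have := congrArg Fin.val (congrFun hxy i)
  simp only at this
  rw [(hn x i).2.2, (hn y i).2.2, this]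

lemma subsingleton_lpGrid_one : Subsingleton (lpGrid p d 1) := by
  refine ⟨fun x y => Subtype.ext ?_⟩
  ext i
  obtain ⟨k, hk1, hk2, hk⟩ := x.2 i
  obtain ⟨l, hl1, hl2, hl⟩ := y.2 i
  rw [hk, hl, show k = l by omega]

variable [Fact (1 ≤ p)]

/-- Medians of integer coordinates can be taken to be integers, so the translated points stay
integral and keep mutual distances at least 1. -/
theorem exists_sketch_lpGrid (hp : p ≠ ∞) (μ : Measure (lpGrid p d Δ)) [IsProbabilityMeasure μ]
    {K m s : ℕ} (hm : 0 < m) (hBm : d * Δ ≤ 2 ^ m) {c η : ℝ}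
    (hη0 : 0 < η) (hη1 : η < 1) (hc : 2 ^ 26 ≤ c * η) (hK : 40 * (1 - η) ^ (-p.toReal) ≤ K)
    (hs : ((2 * d + 1) ^ K + 1) ^ (32 * m) ≤ 2 ^ s) (hBs : d * Δ + 1 ≤ 2 ^ s) :
    ∃ D : Measure (SketchPair (lpGrid p d Δ) s), IsAvgDistortionSketch μ c D ∧
      ∀ x y : lpGrid p d Δ,
        ENNReal.ofReal (1 - (1 / 2) ^ m) ≤ D {t | (t.output x y : ℝ) ≤ dist x y} := by
  choose n hn using fun x : lpGrid p d Δ => x.2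
  choose k hk hk1 hk2 using fun i => exists_nat_median μ (fun x => n x i) fun x => (hn x i).2.1
  let z : PiLp p fun _ : Fin d => ℝ := WithLp.toLp p fun i => (k i : ℝ)
  have hcoord : ∀ x i, (x.1 - z) i = (n x i : ℝ) - k i := fun x i => by
    simp [z, (hn x i).2.2]
  refine exists_sketch_of_coordinatewise_median_zero hp μ (v := fun x => x.1 - z) (B := d * Δ)
    (fun x y => ?_) (fun x i => ⟨n x i - k i, by rw [hcoord]; push_cast; rfl⟩)
    (fun i => ?_) (fun i => ?_) (fun x => ?_) hBm hm hη0 hη1 hc hK (by simpa using hs) hBs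
  · rw [Subtype.dist_eq, dist_eq_norm, sub_sub_sub_cancel_right]
  · refine (hk2 i).trans (measure_mono fun x hx => ?_)
    have hx' : k i ≤ n x i := hx
    change 0 ≤ (x.1 - z) i
    rw [hcoord, sub_nonneg]
    exact Nat.cast_le.2 hx'
  · refine (hk1 i).trans (measure_mono fun x hx => ?_)
    have hx' : n x i ≤ k i := hx
    change (x.1 - z) i ≤ 0
    rw [hcoord, sub_nonpos]
    exact Nat.cast_le.2 hx'
  · have h := norm_le_card_mul hp (x.1 - z) (b := Δ) (by positivity) fun i => by
      have h1 : (n x i : ℝ) ≤ Δ := by exact_mod_cast (hn x i).2.1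
      have h2 : (k i : ℝ) ≤ Δ := by exact_mod_cast hk i
      have h3 : (0 : ℝ) ≤ n x i := by positivity
      have h4 : (0 : ℝ) ≤ k i := by positivity
      rw [hcoord, abs_le]
      constructor <;> linarith
    simpa using h

end Grid

lemma exists_sketch_of_subsingleton {X : Type*} [MetricSpace X] [MeasurableSpace X] [Countable X]
    [DiscreteMeasurableSpace X] [Subsingleton X] (μ : Measure X) [IsProbabilityMeasure μ] (c : ℝ) :
    ∃ D : Measure (SketchPair X 0), IsAvgDistortionSketch μ c D ∧
      ∀ x y : X, D {t | (t.output x y : ℝ) ≤ dist x y} = 1 := by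
  refine exists_sketch_of_nat_valued μ (fun _ => 0) (B := 0) (fun _ => le_rfl) (by simp)
    (fun x y => by simp) ?_
  have h : ∀ z : X × X, edist z.1 z.2 = 0 := fun z => by
    rw [Subsingleton.elim z.1 z.2, edist_self]
  simp only [h, lintegral_zero, mul_zero]
  exact zero_le

/-! ### Choice of parameters and size of the sketch. -/

/-- The number of recorded coordinates is at most a power of `2 ^ (q / c)`. -/
lemma one_sub_rpow_neg_le {A : ℕ} (hA : (A : ℝ) = 2 ^ 28) {c q : ℝ} (hc : 2 ^ 27 < c)
    (hq : 0 ≤ q) : (1 - 2 ^ 26 / c) ^ (-q) ≤ ((2 : ℝ) ^ (q / c)) ^ A := by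
  have hc0 : 0 < c := by linarith
  set η : ℝ := 2 ^ 26 / c with hη
  have hη0 : 0 < η := by positivity
  have hη1 : η < 1 / 2 := by
    rw [hη, div_lt_iff₀ hc0]
    linarith
  have h1 : (1 - η)⁻¹ ≤ Real.exp (2 * η) := by
    refine le_trans ?_ (Real.add_one_le_exp _)
    rw [inv_le_iff_one_le_mul₀ (by linarith)]
    nlinarith
  -- Uses `log 2 ≥ 1/2`; then `4 * η * q = 2^28 * (q / c)`, whence the exponent `A`.
  have h2 : Real.exp (2 * η) ≤ 2 ^ (4 * η) := by
    rw [Real.rpow_def_of_pos (by norm_num)]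
    exact Real.exp_le_exp.2 (by nlinarith [Real.log_two_gt_d9])
  rw [Real.rpow_neg (by linarith), ← Real.inv_rpow (by linarith)]
  calc ((1 - η)⁻¹) ^ q ≤ ((2 : ℝ) ^ (4 * η)) ^ q :=
        Real.rpow_le_rpow (inv_nonneg.2 (by linarith)) (h1.trans h2) hq
    _ = ((2 : ℝ) ^ (q / c)) ^ A := by
        rw [← Real.rpow_mul (by norm_num), ← Real.rpow_natCast, ← Real.rpow_mul (by norm_num), hA,
          hη]
        congr 1
        ring

theorem exists_sketch_size_lpGrid {A : ℕ} (hA : (A : ℝ) = 2 ^ 28) {c : ℝ} (hc : 2 ^ 27 < c)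
    {p : ℝ≥0∞} [Fact (1 ≤ p)] (hp : p ≠ ∞) {d Δ : ℕ} (hdΔ : 2 ≤ d * Δ) {δ : ℝ} (hδ0 : 0 < δ)
    (hδ1 : δ < 1) : ∃ s : ℕ,
      (s : ℝ) ≤ (c * p.toReal * (2 : ℝ) ^ (p.toReal / c) *
        Real.log ((d : ℝ) * (Δ : ℝ) / δ)) ^ (A + 3) ∧
      ∀ μ : Measure (lpGrid p d Δ), IsProbabilityMeasure μ →
        ∃ D : Measure (SketchPair (lpGrid p d Δ) s), IsAvgDistortionSketch μ c D ∧
          ∀ x y : lpGrid p d Δ,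
            ENNReal.ofReal (1 - δ) ≤ D {t | (t.output x y : ℝ) ≤ dist x y} := by
  have hq := one_le_toReal hp
  set q := p.toReal
  have hc0 : 0 < c := by linarith
  have hn : (2 : ℝ) ≤ (d : ℝ) * Δ := by exact_mod_cast hdΔ
  have hnδ : (d : ℝ) * Δ ≤ d * Δ / δ := by
    rw [le_div_iff₀ hδ0]
    nlinarith
  set l := Real.log ((d : ℝ) * Δ / δ) with hl
  have hl0 : 0.69 ≤ l := by
    have h1 : Real.log 2 ≤ l := Real.log_le_log (by norm_num) (hn.trans hnδ)
    linarith [Real.log_two_gt_d9]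
  set t := (2 : ℝ) ^ (q / c) with ht
  have ht1 : 1 ≤ t := Real.one_le_rpow (by norm_num) (by positivity)
  set Q := c * q * t * l with hQ
  have hcl : 2 ^ 27 * l ≤ Q := by
    have h1 : (2 : ℝ) ^ 27 ≤ c * q * t := by
      have h2 : c ≤ c * q := le_mul_of_one_le_right hc0.le hq
      have h3 : c * q ≤ c * q * t := le_mul_of_one_le_right (by positivity) ht1
      linarith
    exact mul_le_mul_of_nonneg_right h1 (by linarith)
  have htQ : t ≤ Q := by
    have h1 : 1 ≤ c * q * l := by
      have : c ≤ c * q := le_mul_of_one_le_right hc0.le hq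
      nlinarith
    calc t ≤ (c * q * l) * t := le_mul_of_one_le_left (by linarith) h1
      _ = Q := by rw [hQ]; ring
  -- As `2 log 2 > 1`, this gives `2^m ≥ dΔ/δ`, which bounds both the diameter by `2^m` and the
  -- failure probability `2^{-m}` by `δ`.
  obtain ⟨m, hm1, hm2⟩ : ∃ m : ℕ, 2 * l ≤ m ∧ (m : ℝ) ≤ 2 * l + 1 :=
    ⟨⌈2 * l⌉₊, Nat.le_ceil _, (Nat.ceil_lt_add_one (by linarith)).le⟩
  have hm : 0 < m := by
    have : (0 : ℝ) < m := by linarith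
    exact_mod_cast this
  have hδm : (d : ℝ) * Δ / δ ≤ 2 ^ m := by
    rw [← Real.exp_log (show (0 : ℝ) < d * Δ / δ by positivity), ← hl, ← Real.rpow_natCast,
      Real.rpow_def_of_pos (by norm_num)]
    exact Real.exp_le_exp.2 (by nlinarith [Real.log_two_gt_d9])
  have hnm : d * Δ ≤ 2 ^ m := by exact_mod_cast hnδ.trans hδm
  set η : ℝ := 2 ^ 26 / c with hη
  have hη0 : 0 < η := by positivity
  have hη1 : η < 1 := by
    rw [hη, div_lt_one hc0]
    linarith
  have hpow : 1 ≤ (1 - η) ^ (-q) :=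
    Real.one_le_rpow_of_pos_of_le_one_of_nonpos (by linarith) (by linarith) (by linarith)
  obtain ⟨K, hK1, hK2⟩ : ∃ K : ℕ, 40 * (1 - η) ^ (-q) ≤ K ∧ (K : ℝ) ≤ 40 * (1 - η) ^ (-q) + 1 :=
    ⟨⌈40 * (1 - η) ^ (-q)⌉₊, Nat.le_ceil _, (Nat.ceil_lt_add_one (by linarith)).le⟩
  have hK0 : 0 < K := by
    have : (0 : ℝ) < K := by linarith
    exact_mod_cast this
  have hKQ : (K : ℝ) ≤ 41 * Q ^ A := by
    have h1 : (1 - η) ^ (-q) ≤ Q ^ A :=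
      (one_sub_rpow_neg_le hA hc (by linarith)).trans (pow_le_pow_left₀ (by linarith) htQ A)
    linarith
  refine ⟨32 * m * K * (m + 2), ?_, fun μ hμ => ?_⟩
  · push_cast
    have hQ0 : 0 < Q := by linarith
    calc (32 : ℝ) * m * K * (m + 2) ≤ 32 * Q * (41 * Q ^ A) * Q := by
          gcongr <;> linarith
      _ = 1312 * Q ^ (A + 2) := by ring
      _ ≤ Q * Q ^ (A + 2) := by
          gcongr
          linarith
      _ = Q ^ (A + 3) := by ring
  · have hd : 0 < d := Nat.pos_of_ne_zero fun h => by simp [h] at hdΔ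
    have hΔ : 0 < Δ := Nat.pos_of_ne_zero fun h => by simp [h] at hdΔ
    have hdm : d ≤ 2 ^ m := (Nat.le_mul_of_pos_right d hΔ).trans hnm
    have hs1 : ((2 * d + 1) ^ K + 1) ^ (32 * m) ≤ 2 ^ (32 * m * K * (m + 2)) := by
      calc ((2 * d + 1) ^ K + 1) ^ (32 * m) ≤ ((2 ^ (m + 2)) ^ K) ^ (32 * m) := by
            gcongr
            refine Nat.succ_le_of_lt (Nat.pow_lt_pow_left ?_ hK0.ne')
            rw [pow_add]
            omega
        _ = 2 ^ (32 * m * K * (m + 2)) := by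
            rw [← pow_mul, ← pow_mul]
            congr 1
            ring
    have hs2 : d * Δ + 1 ≤ 2 ^ (32 * m * K * (m + 2)) := by
      calc d * Δ + 1 ≤ 2 ^ (m + 1) := by
            have := Nat.one_le_two_pow (n := m)
            rw [pow_succ]
            omega
        _ ≤ 2 ^ (32 * m * K * (m + 2)) := by
            refine Nat.pow_le_pow_right (by norm_num) ?_
            calc m + 1 ≤ 1 * (m + 2) := by omega
              _ ≤ _ := by
                gcongr
                exact Nat.mul_pos (by omega) hK0
    have hcη : 2 ^ 26 ≤ c * η := by
      rw [hη, mul_div_cancel₀ _ hc0.ne']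
    obtain ⟨D, hD, hprob⟩ := exists_sketch_lpGrid hp μ hm hnm hη0 hη1 hcη hK1 hs1 hs2
    refine ⟨D, hD, fun x y => le_trans (ENNReal.ofReal_le_ofReal ?_) (hprob x y)⟩
    have h1 : (1 : ℝ) / δ ≤ 2 ^ m := le_trans (by gcongr; linarith) hδm
    have h2 : (1 / 2 : ℝ) ^ m ≤ δ := by
      rw [one_div_pow, one_div_le (by positivity) hδ0]
      exact h1
    linarith

theorem theorem1 :
    ∃ (c₀ C : ℝ) (k : ℕ), 1 ≤ c₀ ∧
      ∀ c : ℝ, c₀ < c → ∀ (p : ℝ≥0∞) [Fact (1 ≤ p)], p ≠ ∞ →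
      ∀ d Δ : ℕ, 1 ≤ d → 1 ≤ Δ →
        (∃ s : ℕ,
          (s : ℝ) ≤ C * (c * p.toReal * (2 : ℝ) ^ (p.toReal / c) *
            Real.log ((d : ℝ) * (Δ : ℝ))) ^ k ∧
          ∀ μ : Measure (lpGrid p d Δ), IsProbabilityMeasure μ →
            ∃ D : Measure (SketchPair (lpGrid p d Δ) s), IsAvgDistortionSketch μ c D) ∧
        (∀ δ : ℝ, 0 < δ → δ < 1 → ∃ s : ℕ,
          (s : ℝ) ≤ C * (c * p.toReal * (2 : ℝ) ^ (p.toReal / c) *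
            Real.log ((d : ℝ) * (Δ : ℝ) / δ)) ^ k ∧
          ∀ μ : Measure (lpGrid p d Δ), IsProbabilityMeasure μ →
            ∃ D : Measure (SketchPair (lpGrid p d Δ) s), IsAvgDistortionSketch μ c D ∧
              ∀ x y : lpGrid p d Δ,
                ENNReal.ofReal (1 - δ) ≤ D {t | (t.output x y : ℝ) ≤ dist x y}) := by
  obtain ⟨A, hA⟩ : ∃ A : ℕ, (A : ℝ) = 2 ^ 28 := ⟨2 ^ 28, by norm_num⟩
  refine ⟨2 ^ 27, 2 ^ (A + 3), A + 3, by norm_num, ?_⟩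
  intro c hc p _ hp d Δ hd hΔ
  have hc0 : 0 < c := by linarith
  have hC : (1 : ℝ) ≤ 2 ^ (A + 3) := one_le_pow₀ (by norm_num)
  have hn : (1 : ℝ) ≤ (d : ℝ) * Δ := by exact_mod_cast Nat.mul_pos hd hΔ
  have hlog : 0 ≤ Real.log ((d : ℝ) * Δ) := Real.log_nonneg hn
  rcases (Nat.succ_le_of_lt (Nat.mul_pos hd hΔ)).eq_or_lt' with h1 | h2
  -- Here `log (dΔ) = 0` allows no bits at all, but the grid is a single point.
  · obtain rfl : Δ = 1 := Nat.eq_one_of_mul_eq_one_left h1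
    have := subsingleton_lpGrid_one (p := p) (d := d)
    refine ⟨⟨0, ?_, fun μ _ => ?_⟩, fun δ hδ0 hδ1 => ⟨0, ?_, fun μ _ => ?_⟩⟩
    · rw [Nat.cast_zero]
      positivity
    · obtain ⟨D, hD, -⟩ := exists_sketch_of_subsingleton μ c
      exact ⟨D, hD⟩
    · have : 0 ≤ Real.log ((d : ℝ) * (1 : ℕ) / δ) :=
        Real.log_nonneg ((one_le_div hδ0).2 (by linarith))
      rw [Nat.cast_zero]
      positivity
    · obtain ⟨D, hD, hprob⟩ := exists_sketch_of_subsingleton μ c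
      refine ⟨D, hD, fun x y => ?_⟩
      rw [hprob, ← ENNReal.ofReal_one]
      exact ENNReal.ofReal_le_ofReal (by linarith)
  · refine ⟨?_, fun δ hδ0 hδ1 => ?_⟩
    -- Any fixed `δ` serves for the first part; `log (2dΔ) ≤ 2 log (dΔ)` costs the constant `2^(A +
    -- 3)`.
    · obtain ⟨s, hs, h⟩ := exists_sketch_size_lpGrid hA hc hp h2 (δ := 1 / 2) (by norm_num)
        (by norm_num)
      refine ⟨s, hs.trans ?_, fun μ hμ => (h μ hμ).imp fun D hD => hD.1⟩
      have hn2 : (2 : ℝ) ≤ (d : ℝ) * Δ := by exact_mod_cast h2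
      have hle : Real.log ((d : ℝ) * Δ / (1 / 2)) ≤ 2 * Real.log ((d : ℝ) * Δ) := by
        rw [← Real.log_rpow (by linarith)]
        refine Real.log_le_log (by positivity) ?_
        rw [Real.rpow_two]
        nlinarith
      have hpos : 0 ≤ Real.log ((d : ℝ) * Δ / (1 / 2)) := Real.log_nonneg (by linarith)
      rw [← mul_pow]
      refine pow_le_pow_left₀ (by positivity) ?_ _
      calc c * p.toReal * (2 : ℝ) ^ (p.toReal / c) * Real.log ((d : ℝ) * Δ / (1 / 2))
          ≤ c * p.toReal * (2 : ℝ) ^ (p.toReal / c) * (2 * Real.log ((d : ℝ) * Δ)) := by gcongr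
        _ = _ := by ring
    · obtain ⟨s, hs, h⟩ := exists_sketch_size_lpGrid hA hc hp h2 hδ0 hδ1
      refine ⟨s, hs.trans (le_mul_of_one_le_left ?_ hC), h⟩
      exact (Nat.cast_nonneg s).trans hs
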